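/- A \emph{polytope} is the convex hull of a finite set of points in some $\mathbb{R}^n$, and a \emph{$d$-polytope} is a nonempty polytope whose affine hull has dimension $d$. A \emph{cubical $d$-polytope} is a $d$-polytope each of whose facets is a $(d-1)$-cube, that is, has face lattice isomorphic to the face lattice of $[0,1]^{d-1}$. The \emph{graph} of a polytope is the undirected graph formed by its vertices and edges. A graph is \emph{$k$-linked} if it has at least $2k$ vertices and, for every set of exactly $2k$ vertices and every partition of this set into unordered pairs $\{s_1,t_1\},\dots,\{s_k,t_k\}$, there are pairwise vertex-disjoint paths $L_1,\dots,L_k$ in the graph such that $L_i$ joins $s_i$ to $t_i$ for each $i$; a polytope is $k$-linked if its graph is. \textbf{Proposition.} For every $d\ge 1$, every cubical $d$-polytope is $\lfloor d/2\rfloor$-linked. -/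

import Mathlib

section LinkedGraphs

/-- A graph `G` is `k`-linked if it has at least `2k` vertices and, for any `2k` distinct vertices
`s 0, …, s (k-1), t 0, …, t (k-1)`, there are pairwise vertex-disjoint paths joining `s i` to `t i`
for all `i`. (The families `s`, `t` range over all labelled pairings of all sets of exactly `2k`
vertices.) -/
def SimpleGraph.IsLinked {V : Type*} (G : SimpleGraph V) (k : ℕ) : Prop :=
  ((2 * k : ℕ) : ℕ∞) ≤ ENat.card V ∧
    ∀ s t : Fin k → V, Function.Injective (Sum.elim s t) →
      ∃ p : ∀ i, G.Path (s i) (t i),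
        Pairwise fun i j => List.Disjoint (p i).1.support (p j).1.support

end LinkedGraphs

namespace Polytope

/-- A (convex) polytope is the convex hull of a finite set of points. -/
def IsPolytope {E : Type*} [AddCommGroup E] [Module ℝ E] (P : Set E) : Prop :=
  ∃ S : Finset E, P = convexHull ℝ (S : Set E)

/-- The dimension of the affine hull of `P` (with value `0` at the empty set, which is excluded
wherever this is used). -/
noncomputable def dim {E : Type*} [AddCommGroup E] [Module ℝ E] (P : Set E) : ℕ :=
  Module.finrank ℝ (vectorSpan ℝ P)

variable {E : Type*} [AddCommGroup E] [Module ℝ E] [TopologicalSpace E]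

/-- The face lattice of `P`: the sets of maximisers on `P` of continuous linear functionals,
together with the empty face, ordered by inclusion. (The zero functional gives the face `P`.) -/
abbrev FaceLattice (P : Set E) : Type _ :=
  {F : Set E // IsExposed ℝ P F}

/-- Two polytopes are combinatorially equivalent if their face lattices are isomorphic. -/
def CombEquiv {E' : Type*} [AddCommGroup E'] [Module ℝ E'] [TopologicalSpace E']
    (P : Set E) (Q : Set E') : Prop :=
  Nonempty (FaceLattice P ≃o FaceLattice Q)

/-- The geometric cube `[0, 1]^m` in `ℝ^m`. -/
def unitCube (m : ℕ) : Set (Fin m → ℝ) :=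
  Set.Icc 0 1

/-- A facet of `P` is a nonempty face of dimension `dim P - 1`. -/
def IsFacet (P F : Set E) : Prop :=
  IsExposed ℝ P F ∧ F.Nonempty ∧ dim F + 1 = dim P

/-- A cubical `d`-polytope: a nonempty polytope of dimension `d`, each facet `F` of which is
combinatorially equivalent to the cube of dimension `dim F`. -/
structure IsCubicalPolytope (d : ℕ) (P : Set E) : Prop where
  isPolytope : IsPolytope P
  nonempty : P.Nonempty
  dim_eq : dim P = d
  cubical : ∀ F : Set E, IsFacet P F → CombEquiv F (unitCube (dim F))

/-- The graph of `P`: its vertices are the points `v` such that `{v}` is a face of `P`, and two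
distinct vertices are adjacent when the segment between them is a face (that is, an edge)
of `P`. -/
def graph (P : Set E) : SimpleGraph (P.exposedPoints ℝ) where
  Adj v w := v ≠ w ∧ IsExposed ℝ P (segment ℝ (v : E) (w : E))
  symm := ⟨fun v w h => ⟨h.1.symm, segment_symm ℝ (v : E) (w : E) ▸ h.2⟩⟩
  loopless := ⟨fun _ h => h.1 rfl⟩

end Polytope

/-!
Put `k = ⌊d / 2⌋`. By Balinski's theorem the graph of a `d`-polytope stays connected when fewer
than `d` vertices are deleted; this settles `k ≤ 1`. For `k ≥ 3` choose a facet. Menger's theorem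
joins the `2k` terminals to distinct vertices of the facet by disjoint walks that meet the facet
only at their ends, and it remains to link these ends inside the facet, whose graph is that of an
`m`-cube with `m = d - 1` and `2k ≤ m + 1`.

Linkages in cubes are found by induction on the dimension, in the stronger form that allows a set of
forbidden vertices, as long as there are at most `m + 1` terminals and forbidden vertices in all.
Call these vertices marked. The induction step chooses a pair `s`, `t` and a direction `i` such that
no two marked vertices other than `s` differ only in the coordinate `i`. The facet `x i = s i` is
used to join `s` to `t`; the other terminals move along `i` into the opposite facet, where they are
linked by induction, the projections of `t` and of the forbidden vertices being forbidden. The first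
facet may contain one marked vertex too many for its connectivity; then parity shows that they
cannot be all the neighbours of one vertex, or that another choice of the pair or the direction
works.

The cube argument needs `m ≥ 4`, since the `3`-cube is not `2`-linked. For `k = 2` a hyperplane
through three of the four terminals and the centroid of the vertices has one pair on it, and the
other pair on one of its closed sides; each pair is then joined through a different open side.
-/
section Walks

variable {V W : Type*} {G H : SimpleGraph V} {D D' B : Set V} {u v x y z : V}

/-- `ReachableIn G D x y` means that some walk of `G` from `x` to `y` has all its vertices
in `D`. -/
def ReachableIn (G : SimpleGraph V) (D : Set V) (x y : V) : Prop :=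
  ∃ p : G.Walk x y, ∀ z ∈ p.support, z ∈ D

namespace ReachableIn

theorem refl (h : x ∈ D) : ReachableIn G D x x :=
  ⟨.nil, by simpa using h⟩

theorem left_mem : ReachableIn G D x y → x ∈ D
  | ⟨p, hp⟩ => hp _ p.start_mem_support

theorem right_mem : ReachableIn G D x y → y ∈ D
  | ⟨p, hp⟩ => hp _ p.end_mem_support

theorem symm : ReachableIn G D x y → ReachableIn G D y x
  | ⟨p, hp⟩ => ⟨p.reverse, by simpa using hp⟩

theorem trans : ReachableIn G D x y → ReachableIn G D y z → ReachableIn G D x z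
  | ⟨p, hp⟩, ⟨q, hq⟩ => ⟨p.append q, fun w hw =>
      ((p.mem_support_append_iff q).1 hw).elim (hp w) (hq w)⟩

theorem of_adj (h : G.Adj x y) (hx : x ∈ D) (hy : y ∈ D) : ReachableIn G D x y :=
  ⟨h.toWalk, by simp [hx, hy]⟩

theorem head (h : G.Adj x y) (hx : x ∈ D) (hyz : ReachableIn G D y z) : ReachableIn G D x z :=
  (of_adj h hx hyz.left_mem).trans hyz

theorem mono (hD : D ⊆ D') : ReachableIn G D x y → ReachableIn G D' x y
  | ⟨p, hp⟩ => ⟨p, fun z hz => hD (hp z hz)⟩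

theorem map {G' : SimpleGraph W} (f : G →g G') {D' : Set W} (hD : Set.MapsTo f D D') :
    ReachableIn G D x y → ReachableIn G' D' (f x) (f y)
  | ⟨p, hp⟩ => ⟨p.map f, by simpa using fun z hz => hD (hp z hz)⟩

theorem mono_graph (hGH : G ≤ H) (h : ReachableIn G D x y) : ReachableIn H D x y :=
  h.map (SimpleGraph.Hom.ofLE hGH) (Set.mapsTo_id D)

theorem exists_path : ReachableIn G D x y → ∃ p : G.Path x y, ∀ z ∈ p.1.support, z ∈ D
  | ⟨p, hp⟩ => by
    classical
    exact ⟨p.toPath, fun z hz => hp z (p.support_toPath_subset_support hz)⟩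

theorem exists_first_hit (h : ReachableIn G D x y) (hB : ¬ ReachableIn G (D \ B) x y) :
    ∃ b ∈ B, b ∈ D ∧ ReachableIn G (insert b {z | ReachableIn G (D \ B) x z}) x b := by
  obtain ⟨p, hp⟩ := h
  induction p with
  | @nil x =>
    have hx : x ∈ D := hp x (by simp)
    exact ⟨x, by_contra fun hxB => hB (.refl ⟨hx, hxB⟩), hx, .refl (Set.mem_insert x _)⟩
  | @cons x c y hxc p ih =>
    have hx : x ∈ D := hp x (by simp)
    by_cases hxB : x ∈ B
    · exact ⟨x, hxB, hx, .refl (Set.mem_insert x _)⟩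
    obtain ⟨b, hbB, hbD, hcb⟩ := ih (fun hcy => hB (hcy.head hxc ⟨hx, hxB⟩))
      fun z hz => hp z (by simp [hz])
    have hcx : {z | ReachableIn G (D \ B) c z} ⊆ {z | ReachableIn G (D \ B) x z} :=
      fun z hz => hz.head hxc ⟨hx, hxB⟩
    exact ⟨b, hbB, hbD, (hcb.mono (Set.insert_subset_insert hcx)).head hxc
      (Set.mem_insert_of_mem b (.refl ⟨hx, hxB⟩))⟩

theorem deleteEdge (h : ReachableIn G D x y) :
    ReachableIn (G.deleteEdges {s(u, v)}) D x y ∨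
    (ReachableIn (G.deleteEdges {s(u, v)}) D x u ∧ ReachableIn (G.deleteEdges {s(u, v)}) D v y) ∨
    (ReachableIn (G.deleteEdges {s(u, v)}) D x v ∧
      ReachableIn (G.deleteEdges {s(u, v)}) D u y) := by
  obtain ⟨p, hp⟩ := h
  induction p with
  | nil => exact .inl (.refl (hp _ (by simp)))
  | @cons x c y hxc p ih =>
    have hx : x ∈ D := hp x (by simp)
    specialize ih fun z hz => hp z (by simp [hz])
    by_cases he : s(x, c) = s(u, v)
    · rcases Sym2.eq_iff.1 he with ⟨rfl, rfl⟩ | ⟨rfl, rfl⟩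
      · rcases ih with ih | ⟨-, ih⟩ | ⟨-, ih⟩
        exacts [.inr (.inl ⟨.refl hx, ih⟩), .inr (.inl ⟨.refl hx, ih⟩), .inl ih]
      · rcases ih with ih | ⟨-, ih⟩ | ⟨-, ih⟩
        exacts [.inr (.inr ⟨.refl hx, ih⟩), .inl ih, .inr (.inr ⟨.refl hx, ih⟩)]
    · have hxc' : (G.deleteEdges {s(u, v)}).Adj x c :=
        SimpleGraph.deleteEdges_adj.2 ⟨hxc, he⟩
      rcases ih with ih | ⟨ih, h⟩ | ⟨ih, h⟩
      exacts [.inl (ih.head hxc' hx), .inr (.inl ⟨ih.head hxc' hx, h⟩),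
        .inr (.inr ⟨ih.head hxc' hx, h⟩)]

end ReachableIn

end Walks

section Menger

variable {V : Type*} {G : SimpleGraph V} {A B : Set V} {S : Finset V} {x y : V} {n : ℕ}

/-- `S` meets every walk of `G` from `A` to `B`; the vertices of `A ∩ B` count as walks of
length zero. -/
def Separates (G : SimpleGraph V) (S : Finset V) (A B : Set V) : Prop :=
  ∀ a ∈ A, ∀ b ∈ B, ¬ ReachableIn G (S : Set V)ᶜ a b

theorem Separates.symm (h : Separates G S A B) : Separates G S B A :=
  fun b hb a ha hba => h a ha b hb hba.symm

theorem Separates.insert_of_deleteEdges [DecidableEq V]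
    (h : Separates (G.deleteEdges {s(x, y)}) S A B) : Separates G (insert x S) A B := by
  intro a ha b hb hab
  have hx : x ∉ ((insert x S : Finset V) : Set V)ᶜ := by simp
  rcases hab.deleteEdge (u := x) (v := y) with hab | ⟨hax, -⟩ | ⟨-, hxb⟩
  · exact h a ha b hb (hab.mono (by simp))
  · exact hx hax.right_mem
  · exact hx hxb.left_mem

/-- The existence of `n` pairwise disjoint walks of `G` from `A` to `B`, the `i`-th of them inside
the vertex set `D i`. -/
def HasDisjointWalks (G : SimpleGraph V) (A B : Set V) (n : ℕ) : Prop :=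
  ∃ (a b : Fin n → V) (D : Fin n → Set V), (∀ i, a i ∈ A) ∧ (∀ i, b i ∈ B) ∧
    (∀ i, ReachableIn G (D i) (a i) (b i)) ∧ Pairwise fun i j => Disjoint (D i) (D j)

namespace HasDisjointWalks

theorem of_fintype {ι : Type*} [Fintype ι] {a b : ι → V} {D : ι → Set V} (ha : ∀ i, a i ∈ A)
    (hb : ∀ i, b i ∈ B) (hab : ∀ i, ReachableIn G (D i) (a i) (b i))
    (hD : Pairwise fun i j => Disjoint (D i) (D j)) :
    HasDisjointWalks G A B (Fintype.card ι) :=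
  have e := (Fintype.equivFin ι).symm
  ⟨a ∘ e, b ∘ e, D ∘ e, fun _ => ha _, fun _ => hb _, fun _ => hab _,
    fun _ _ hij => hD (e.injective.ne hij)⟩

theorem mono_graph {G' : SimpleGraph V} (hG : G' ≤ G) :
    HasDisjointWalks G' A B n → HasDisjointWalks G A B n
  | ⟨a, b, D, ha, hb, hab, hD⟩ => ⟨a, b, D, ha, hb, fun i => (hab i).mono_graph hG, hD⟩

/-- The walks are cut off where they first meet the range of `f`. -/
theorem exists_walks_to {ι : Type*} [Fintype ι] {f : ι → V}
    (h : HasDisjointWalks G A (Set.range f) (Fintype.card ι)) :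
    ∃ D : ι → Set V, (∀ i, ∃ a ∈ A, ReachableIn G (D i) a (f i)) ∧
      (∀ i, ∀ z ∈ D i, z = f i ∨ ∃ a ∈ A, ReachableIn G (Set.range f)ᶜ a z) ∧
      Pairwise fun i j => Disjoint (D i) (D j) := by
  obtain ⟨a, b, D, ha, hb, hab, hD⟩ := h
  choose e he using hb
  have heinj : Function.Injective e := fun i j hij => by
    by_contra hne
    refine Set.disjoint_left.1 (hD hne) (hab i).right_mem ?_
    rw [← he i, hij, he j]
    exact (hab j).right_mem
  let σ : Fin (Fintype.card ι) ≃ ι :=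
    .ofBijective e ((Fintype.bijective_iff_injective_and_card e).2 ⟨heinj, by simp⟩)
  have hσ : ∀ i, b (σ.symm i) = f i := fun i =>
    (he _).symm.trans (congrArg f (σ.apply_symm_apply i))
  have hmeet : ∀ i, ∀ j, f j ∈ D (σ.symm i) → j = i := fun i j hj => by
    by_contra hne
    refine Set.disjoint_left.1 (hD (σ.symm.injective.ne hne)) ?_ hj
    exact hσ j ▸ (hab _).right_mem
  have htrim : ∀ i, ReachableIn G
      (insert (f i) {z | ReachableIn G (D (σ.symm i) \ Set.range f) (a (σ.symm i)) z})
      (a (σ.symm i)) (f i) := fun i => by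
    obtain ⟨_, ⟨j, rfl⟩, hj, hij⟩ := (hσ i ▸ hab (σ.symm i)).exists_first_hit (B := Set.range f)
      fun h => h.right_mem.2 ⟨i, rfl⟩
    rwa [hmeet i j hj] at hij
  refine ⟨_, fun i => ⟨_, ha _, htrim i⟩, fun i z hz => ?_, fun i j hij => ?_⟩
  · exact hz.imp_right fun hz => ⟨_, ha _, hz.mono fun w hw => hw.2⟩
  · refine (hD (σ.symm.injective.ne hij)).mono ?_ ?_ <;>
      exact Set.insert_subset (hσ _ ▸ (hab _).right_mem) fun z hz => hz.right_mem.1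

end HasDisjointWalks

theorem hasDisjointWalks_bot [Finite V]
    (hsep : ∀ S : Finset V, Separates ⊥ S A B → n ≤ S.card) :
    HasDisjointWalks (⊥ : SimpleGraph V) A B n := by
  obtain ⟨T, hT⟩ := (Set.toFinite (A ∩ B)).exists_finset_coe
  have hTn : n ≤ T.card := hsep T fun a ha b hb ⟨p, hp⟩ => by
    cases p with
    | nil => exact hp a (by simp) (hT ▸ ⟨ha, hb⟩)
    | cons h _ => exact h
  obtain ⟨T', hT', rfl⟩ := Finset.exists_subset_card_eq hTn
  have hmem : ∀ v : T', (v : V) ∈ A ∩ B := fun v => hT ▸ hT' v.2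
  rw [← Fintype.card_coe]
  exact .of_fintype (fun v => (hmem v).1) (fun v => (hmem v).2)
    (fun v => .refl (Set.mem_singleton (v : V))) fun v w hvw =>
      Set.disjoint_singleton.2 (Subtype.coe_injective.ne hvw)

/-- Half of the induction step of Menger's theorem: `S ∪ {x}`, indexed by `Option S`, separates `A`
from `B` in `G`, so a set separating `A` from `S ∪ {x}` in `G - xy` separates `A` from `B` in
`G`. -/
theorem exists_walks_to_separator
    (ih : ∀ B : Set V, (∀ S, Separates (G.deleteEdges {s(x, y)}) S A B → n ≤ S.card) →
      HasDisjointWalks (G.deleteEdges {s(x, y)}) A B n)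
    (hsep : ∀ S, Separates G S A B → n ≤ S.card)
    (hS : Separates (G.deleteEdges {s(x, y)}) S A B) (hn : S.card + 1 = n)
    {a b : V} (ha : a ∈ A) (hb : b ∈ B)
    (hax : ReachableIn (G.deleteEdges {s(x, y)}) (S : Set V)ᶜ a x)
    (hyb : ReachableIn (G.deleteEdges {s(x, y)}) (S : Set V)ᶜ y b) :
    ∃ D : Option S → Set V,
      (∀ i, ∃ a ∈ A, ReachableIn (G.deleteEdges {s(x, y)}) (D i) a (i.elim x (↑))) ∧
      (∀ i, ∀ z ∈ D i, (∃ s : S, i = some s ∧ z = s) ∨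
        ∃ a ∈ A, ReachableIn (G.deleteEdges {s(x, y)}) (S : Set V)ᶜ a z) ∧
      Pairwise fun i j => Disjoint (D i) (D j) := by
  classical
  have hxS : x ∉ S := hax.right_mem
  let f : Option S → V := fun i => i.elim x (↑)
  have hrange : Set.range f = ((insert x S : Finset V) : Set V) := by
    ext z
    simp [f, Option.exists, eq_comm]
  have hwalks : HasDisjointWalks (G.deleteEdges {s(x, y)}) A (Set.range f) n := by
    refine ih _ fun T hT => hsep T fun a' ha' b' hb' hab => ?_
    obtain ⟨p, hpf, hpT, hp⟩ := hab.exists_first_hit (B := Set.range f) fun h =>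
      hS.insert_of_deleteEdges a' ha' b' hb' (h.mono fun z hz => hrange ▸ hz.2)
    have hsub : insert p {z | ReachableIn G ((T : Set V)ᶜ \ Set.range f) a' z} ⊆ (T : Set V)ᶜ :=
      Set.insert_subset hpT fun z hz => hz.right_mem.1
    rcases hp.deleteEdge (u := x) (v := y) with h | ⟨h, -⟩ | ⟨h, hxp⟩
    · exact hT a' ha' p hpf (h.mono hsub)
    · exact hT a' ha' x ⟨none, rfl⟩ (h.mono hsub)
    · obtain rfl : x = p := hxp.left_mem.resolve_right fun h => h.right_mem.2 ⟨none, rfl⟩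
      refine hS a' ha' b hb (ReachableIn.trans (h.mono ?_) hyb)
      exact Set.insert_subset hxS fun z hz hzS => hz.right_mem.2 ⟨some ⟨z, hzS⟩, rfl⟩
  obtain ⟨D, hD, hDS, hdisj⟩ := HasDisjointWalks.exists_walks_to (f := f)
    (by simpa [hn] using hwalks)
  refine ⟨D, hD, fun i z hz => ?_, hdisj⟩
  rcases hDS i z hz with rfl | ⟨a', ha', h⟩
  · rcases i with _ | s
    exacts [.inr ⟨a, ha, hax⟩, .inl ⟨s, rfl, rfl⟩]
  · exact .inr ⟨a', ha', h.mono fun w hw hwS => (hw : w ∉ Set.range f) ⟨some ⟨w, hwS⟩, rfl⟩⟩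

/-- The walks on the two sides of `S` are glued along `S` and the edge `xy`; a vertex outside `S`
on both sides would give a walk from `A` to `B` in `G - xy` avoiding `S`. -/
theorem hasDisjointWalks_of_deleteEdges (hxy : G.Adj x y)
    (ih : ∀ A B : Set V, (∀ S, Separates (G.deleteEdges {s(x, y)}) S A B → n ≤ S.card) →
      HasDisjointWalks (G.deleteEdges {s(x, y)}) A B n)
    (hsep : ∀ S, Separates G S A B → n ≤ S.card)
    (hS : Separates (G.deleteEdges {s(x, y)}) S A B) (hn : S.card + 1 = n)
    {a b : V} (ha : a ∈ A) (hb : b ∈ B)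
    (hax : ReachableIn (G.deleteEdges {s(x, y)}) (S : Set V)ᶜ a x)
    (hyb : ReachableIn (G.deleteEdges {s(x, y)}) (S : Set V)ᶜ y b) :
    HasDisjointWalks G A B n := by
  obtain ⟨D, hD, hDS, hDD⟩ := exists_walks_to_separator (fun B => ih A B) hsep hS hn ha hb hax hyb
  obtain ⟨E, hE, hES, hEE⟩ := exists_walks_to_separator (G := G) (x := y) (y := x) (A := B) (B := A)
    (by simpa only [Sym2.eq_swap] using fun A => ih B A) (fun S h => hsep S h.symm)
    (by simpa only [Sym2.eq_swap] using hS.symm) hn hb ha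
    (by simpa only [Sym2.eq_swap] using hyb.symm) (by simpa only [Sym2.eq_swap] using hax.symm)
  rw [Sym2.eq_swap] at hE hES
  have hcross : ∀ i j, i ≠ j → Disjoint (D i) (E j) := fun i j hij =>
    Set.disjoint_left.2 fun z hzD hzE => by
      rcases hDS i z hzD with ⟨s, rfl, rfl⟩ | ⟨a', ha', hz⟩
      · rcases hES j s hzE with ⟨t, rfl, hst⟩ | ⟨b', -, hz⟩
        exacts [hij (congrArg some (Subtype.ext hst)), hz.right_mem s.2]
      · rcases hES j z hzE with ⟨t, rfl, rfl⟩ | ⟨b', hb', hz'⟩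
        exacts [hz.right_mem t.2, hS a' ha' b' hb' (hz.trans hz'.symm)]
  choose a' ha' hD' using hD
  choose b' hb' hE' using hE
  have hcard : Fintype.card (Option S) = n := by simp [hn]
  rw [← hcard]
  refine .of_fintype (D := fun i => D i ∪ E i) ha' hb' (fun i => ?_) fun i j hij =>
    Set.disjoint_union_left.2 ⟨Set.disjoint_union_right.2 ⟨hDD hij, hcross i j hij⟩,
      Set.disjoint_union_right.2 ⟨(hcross j i hij.symm).symm, hEE hij⟩⟩
  have hDi := ((hD' i).mono_graph (SimpleGraph.deleteEdges_le _)).mono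
    (Set.subset_union_left (t := E i))
  have hEi := ((hE' i).symm.mono_graph (SimpleGraph.deleteEdges_le _)).mono
    (Set.subset_union_right (s := D i))
  rcases i with _ | s
  · exact hDi.trans (hEi.head hxy hDi.right_mem)
  · exact hDi.trans hEi

/-- **Menger's theorem**. -/
theorem hasDisjointWalks_of_separates [Finite V] (n : ℕ) (A B : Set V)
    (hsep : ∀ S, Separates G S A B → n ≤ S.card) : HasDisjointWalks G A B n := by
  classical
  induction G using WellFoundedLT.induction generalizing A B with
  | ind G ih =>
  obtain rfl | hG := eq_or_ne G ⊥
  · exact hasDisjointWalks_bot hsep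
  obtain ⟨x, y, hxy⟩ := SimpleGraph.ne_bot_iff_exists_adj.1 hG
  have hlt : ∀ {x y}, G.Adj x y → G.deleteEdges {s(x, y)} < G := fun {x y} hxy =>
    lt_of_le_of_ne (SimpleGraph.deleteEdges_le _) fun h =>
      (SimpleGraph.deleteEdges_adj.1 (h ▸ hxy)).2 rfl
  by_cases hG' : ∀ S, Separates (G.deleteEdges {s(x, y)}) S A B → n ≤ S.card
  · exact (ih _ (hlt hxy) A B hG').mono_graph (SimpleGraph.deleteEdges_le _)
  push Not at hG'
  obtain ⟨S, hS, hSn⟩ := hG'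
  have hn : S.card + 1 = n := le_antisymm hSn
    ((hsep _ hS.insert_of_deleteEdges).trans (Finset.card_insert_le x S))
  obtain ⟨a, ha, b, hb, hab⟩ : ∃ a ∈ A, ∃ b ∈ B, ReachableIn G (S : Set V)ᶜ a b := by
    by_contra! h
    exact hSn.not_ge (hsep S h)
  rcases hab.deleteEdge (u := x) (v := y) with hab | ⟨hax, hyb⟩ | ⟨hay, hxb⟩
  · exact absurd hab (hS a ha b hb)
  · exact hasDisjointWalks_of_deleteEdges hxy (ih _ (hlt hxy)) hsep hS hn ha hb hax hyb
  · rw [Sym2.eq_swap] at hS hay hxb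
    exact hasDisjointWalks_of_deleteEdges hxy.symm (ih _ (hlt hxy.symm)) hsep hS hn ha hb hay hxb

end Menger

section Linkage

variable {V W ι : Type*} {G : SimpleGraph V} {H : SimpleGraph W} {D : Set V} {s t : ι → V} {n : ℕ}

/-- Deleting fewer than `n` vertices does not disconnect `G`. In contrast to the usual notion of an
`n`-connected graph, nothing is required of the number of vertices. -/
def IsVertexConnected (G : SimpleGraph V) (n : ℕ) : Prop :=
  ∀ ⦃Y : Finset V⦄, Y.card < n → ∀ x ∉ Y, ∀ y ∉ Y, ReachableIn G (Y : Set V)ᶜ x y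

theorem IsVertexConnected.exists_fan [Finite V] {κ : Type*} [Fintype κ]
    (hG : IsVertexConnected G (Fintype.card κ)) {x : κ → V} (hx : Function.Injective x) {B : Set V}
    (hB : Fintype.card κ ≤ B.ncard) :
    ∃ (c : κ → V) (D : κ → Set V), (∀ i, c i ∈ B ∧ ReachableIn G (D i) (x i) (c i)) ∧
      (∀ i, ∀ z ∈ D i, z ∈ B → z = c i) ∧ Pairwise fun i j => Disjoint (D i) (D j) := by
  classical
  have hwalks : HasDisjointWalks G B (Set.range x) (Fintype.card κ) :=
    hasDisjointWalks_of_separates _ _ _ fun Y hY => by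
      by_contra! hlt
      obtain ⟨b, hbB, hbY⟩ := Set.exists_mem_notMem_of_ncard_lt_ncard (s := (Y : Set V)) (t := B)
        (by simpa using hlt.trans_le hB)
      obtain ⟨_, hi, hiY⟩ := Finset.exists_mem_notMem_of_card_lt_card (s := Y)
        (t := Finset.univ.image x) (by rwa [Finset.card_image_of_injective _ hx])
      obtain ⟨i, -, rfl⟩ := Finset.mem_image.1 hi
      exact hY b hbB (x i) ⟨i, rfl⟩ (hG hlt b hbY (x i) hiY)
  obtain ⟨D, hD, -, hdisj⟩ := hwalks.exists_walks_to
  have htrim : ∀ i, ∃ c ∈ B, c ∈ D i ∧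
      ReachableIn G (insert c {z | ReachableIn G (D i \ B) (x i) z}) (x i) c := fun i => by
    obtain ⟨a, ha, hai⟩ := hD i
    exact hai.symm.exists_first_hit fun h => h.right_mem.2 ha
  choose c hcB hcD hc using htrim
  refine ⟨c, _, fun i => ⟨hcB i, hc i⟩, fun i z hz hzB => ?_, fun i j hij => ?_⟩
  · exact hz.resolve_right fun h => h.right_mem.2 hzB
  · exact (hdisj hij).mono (Set.insert_subset (hcD i) fun z hz => hz.right_mem.1)
      (Set.insert_subset (hcD j) fun z hz => hz.right_mem.1)

/-- There are pairwise disjoint walks of `G` inside `D` that join `s i` to `t i` for all `i`; the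
`i`-th walk stays in the vertex set `A i`. -/
def Linkable (G : SimpleGraph V) (D : Set V) (s t : ι → V) : Prop :=
  ∃ A : ι → Set V, (∀ i, A i ⊆ D) ∧ (∀ i, ReachableIn G (A i) (s i) (t i)) ∧
    Pairwise fun i j => Disjoint (A i) (A j)

theorem linkable_of_subsingleton [Subsingleton ι] (h : ∀ i, ReachableIn G D (s i) (t i)) :
    Linkable G D s t :=
  ⟨fun _ => D, fun _ => subset_rfl, h, fun i j hij => absurd (Subsingleton.elim i j) hij⟩

theorem linkable_of_reachableIn {a : ι} {B : Set V} (hB : B ⊆ D)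
    (ha : ReachableIn G B (s a) (t a))
    (h : Linkable G (D \ B) (fun j : {j // j ≠ a} => s j) fun j => t j) : Linkable G D s t := by
  classical
  obtain ⟨A, hAD, hA, hdisj⟩ := h
  have hAB : ∀ j, Disjoint (A j) B := fun j => Set.disjoint_sdiff_left.mono_left (hAD j)
  refine ⟨fun j => if hj : j = a then B else A ⟨j, hj⟩, fun j => ?_, fun j => ?_,
    fun j k hjk => ?_⟩
  · by_cases hj : j = a
    · simpa [hj]
    · simpa [hj] using (hAD ⟨j, hj⟩).trans Set.sdiff_subset
  · by_cases hj : j = a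
    · simpa [hj]
    · simpa [hj] using hA ⟨j, hj⟩
  · by_cases hj : j = a <;> by_cases hk : k = a
    · exact absurd (hj.trans hk.symm) hjk
    · simpa [hj, hk] using (hAB _).symm
    · simpa [hj, hk] using hAB _
    · simpa [hj, hk] using hdisj fun h => hjk (congrArg Subtype.val h)

theorem isLinked_of_linkable {k : ℕ} (hcard : ((2 * k : ℕ) : ℕ∞) ≤ ENat.card V)
    (h : ∀ s t : Fin k → V, Function.Injective (Sum.elim s t) → Linkable G Set.univ s t) :
    G.IsLinked k := by
  refine ⟨hcard, fun s t hst => ?_⟩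
  obtain ⟨A, -, hA, hdisj⟩ := h s t hst
  choose p hp using fun i => (hA i).exists_path
  exact ⟨p, fun i j hij z hi hj => Set.disjoint_left.1 (hdisj hij) (hp i z hi) (hp j z hj)⟩

/-- A fan joins the terminals to distinct vertices of the copy of `H`, where these are linked. -/
theorem IsVertexConnected.linkable_of_isContained [Finite V] [Fintype ι]
    (hG : IsVertexConnected G (2 * Fintype.card ι)) (hHG : H.IsContained G)
    (hW : 2 * Fintype.card ι ≤ Nat.card W)
    (hH : ∀ s t : ι → W, Function.Injective (Sum.elim s t) → Linkable H Set.univ s t)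
    (hst : Function.Injective (Sum.elim s t)) : Linkable G Set.univ s t := by
  obtain ⟨ψ⟩ := hHG
  have hψinj : Function.Injective ψ := ψ.injective
  have hκ : Fintype.card (ι ⊕ ι) = 2 * Fintype.card ι := by simp [two_mul]
  obtain ⟨c, D, hc, hDψ, hD⟩ := IsVertexConnected.exists_fan (hκ ▸ hG) hst (B := Set.range ψ)
    (by rwa [hκ, ← Set.image_univ, Set.ncard_image_of_injective _ hψinj, Set.ncard_univ])
  choose hcψ hcD using hc
  choose w hw using hcψ
  have hwinj : Function.Injective w := fun p q hpq => by
    by_contra hne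
    refine Set.disjoint_left.1 (hD hne) (hcD p).right_mem ?_
    rw [← hw p, hpq, hw q]
    exact (hcD q).right_mem
  obtain ⟨A, -, hA, hAdisj⟩ := hH (w ∘ Sum.inl) (w ∘ Sum.inr) (by simpa using hwinj)
  have hwA : ∀ p : ι ⊕ ι, w p ∈ A (p.elim id id) := by
    rintro (i | i)
    exacts [(hA i).left_mem, (hA i).right_mem]
  have hcross : ∀ (p : ι ⊕ ι) (j : ι), p.elim id id ≠ j → Disjoint (D p) (ψ '' A j) := by
    refine fun p j hpj => Set.disjoint_left.2 ?_
    rintro _ hz ⟨u, hu, rfl⟩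
    obtain rfl : u = w p := hψinj ((hDψ p _ hz ⟨u, rfl⟩).trans (hw p).symm)
    exact Set.disjoint_left.1 (hAdisj hpj) (hwA p) hu
  refine ⟨fun i => D (.inl i) ∪ D (.inr i) ∪ ψ '' A i, fun _ => Set.subset_univ _, fun i => ?_,
    fun i j hij => ?_⟩
  · have hψ : ReachableIn G (ψ '' A i) (c (.inl i)) (c (.inr i)) := by
      rw [← hw, ← hw]
      exact (hA i).map ψ.toHom (Set.mapsTo_image ψ (A i))
    exact ((hcD (.inl i)).mono fun z hz => .inl (.inl hz)).trans
      ((hψ.mono Set.subset_union_right).trans ((hcD (.inr i)).symm.mono fun z hz => .inl (.inr hz)))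
  · simp only [Set.disjoint_union_left, Set.disjoint_union_right]
    exact ⟨⟨⟨⟨hD (by simpa), hD (by simp)⟩, (hcross (.inl j) i hij.symm).symm⟩,
      ⟨hD (by simp), hD (by simpa)⟩, (hcross (.inr j) i hij.symm).symm⟩,
      ⟨hcross (.inl i) j hij, hcross (.inr i) j hij⟩, (Set.disjoint_image_iff hψinj).2 (hAdisj hij)⟩

end Linkage

section Cube

/-- The graph of the `m`-dimensional cube. -/
def cubeGraph (m : ℕ) : SimpleGraph (Fin m → Bool) where
  Adj x y := ∃ i, y = Function.update x i (!x i)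
  symm := ⟨by
    rintro x y ⟨i, rfl⟩
    exact ⟨i, by simp⟩⟩
  loopless := ⟨by
    rintro x ⟨i, h⟩
    simpa using congrFun h i⟩

namespace cubeGraph

variable {m : ℕ} {i : Fin (m + 1)} {b : Bool} {x y : Fin (m + 1) → Bool}
  {D : Set (Fin (m + 1) → Bool)} {X Y : Finset (Fin (m + 1) → Bool)}

theorem reachableIn_update (hx : x ∈ D) (h : Function.update x i b ∈ D) :
    ReachableIn (cubeGraph (m + 1)) D x (Function.update x i b) := by
  by_cases hb : x i = b
  · rw [← hb, Function.update_eq_self]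
    exact .refl hx
  · exact .of_adj ⟨i, by rw [Bool.eq_not.2 (Ne.symm hb)]⟩ hx h

theorem eq_update_of_removeNth_eq (hxy : x ≠ y) (h : i.removeNth x = i.removeNth y) :
    y = Function.update x i (!x i) := by
  have hy : y = Function.update x i (y i) := by
    rw [← Fin.insertNth_removeNth, h, Fin.insertNth_self_removeNth]
  have hi : y i = !x i := Bool.eq_not.2 fun hi => hxy (by rw [hy, hi, Function.update_eq_self])
  exact hi ▸ hy

theorem card_neighborFinset {m : ℕ} [(cubeGraph m).LocallyFinite] (x : Fin m → Bool) :
    ((cubeGraph m).neighborFinset x).card = m := by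
  have hinj : Function.Injective fun i => Function.update x i (!x i) := fun i j hij => by
    by_contra hne
    simpa [hne] using congrFun hij i
  have himage : (cubeGraph m).neighborFinset x =
      Finset.univ.image fun i => Function.update x i (!x i) := by
    ext y
    simp only [SimpleGraph.mem_neighborFinset, Finset.mem_image, Finset.mem_univ, true_and]
    exact exists_congr fun i => eq_comm
  rw [himage, Finset.card_image_of_injective _ hinj, Finset.card_univ, Fintype.card_fin]

/-- The bipartition of the cube graph by the parity of the number of coordinates equal to `true`. -/
def parity (m : ℕ) : (cubeGraph m).Coloring (ZMod 2) :=
  .mk (fun x => ∑ i, if x i then 1 else 0) <| by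
    rintro x _ ⟨i, rfl⟩
    have hrest : ∑ j ∈ Finset.univ.erase i, (if Function.update x i (!x i) j then 1 else 0) =
        ∑ j ∈ Finset.univ.erase i, (if x j then (1 : ZMod 2) else 0) :=
      Finset.sum_congr rfl fun j hj => by rw [Function.update_of_ne (Finset.ne_of_mem_erase hj)]
    rw [← Finset.add_sum_erase _ _ (Finset.mem_univ i), ← Finset.add_sum_erase _ _
      (Finset.mem_univ i), hrest]
    cases x i <;> simp

theorem parity_eq_of_adj_of_adj {m : ℕ} {x y z : Fin m → Bool} (hx : (cubeGraph m).Adj x z)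
    (hy : (cubeGraph m).Adj y z) : parity m x = parity m y :=
  have two_classes : ∀ a b c : ZMod 2, a ≠ c → b ≠ c → a = b := by decide
  two_classes _ _ _ ((parity m).valid hx) ((parity m).valid hy)

/-- The embedding of the `m`-cube as the facet `x i = b` of the `(m + 1)`-cube. -/
def facet (i : Fin (m + 1)) (b : Bool) : cubeGraph m →g cubeGraph (m + 1) where
  toFun z := i.insertNth b z
  map_rel' := by
    rintro z _ ⟨j, rfl⟩
    exact ⟨i.succAbove j, by simp⟩

@[simp]
theorem facet_apply_self (z : Fin m → Bool) : facet i b z i = b :=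
  Fin.insertNth_apply_same (α := fun _ => Bool) i b z

@[simp]
theorem removeNth_facet (z : Fin m → Bool) : i.removeNth (facet i b z) = z :=
  Fin.removeNth_insertNth (α := fun _ => Bool) i b z

@[simp]
theorem facet_removeNth : facet i b (i.removeNth x) = Function.update x i b :=
  Fin.insertNth_removeNth (α := fun _ => Bool) i b x

theorem facet_removeNth_of_eq (h : x i = b) : facet i b (i.removeNth x) = x := by
  rw [facet_removeNth, ← h, Function.update_eq_self]

theorem succ_le_card_of_forall_update_mem {m : ℕ} {X : Finset (Fin m → Bool)} (hX : X.Nonempty)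
    (h : ∀ i, ∃ x ∈ X, Function.update x i (!x i) ∈ X) : m + 1 ≤ X.card := by
  induction m with
  | zero => simpa using hX.card_pos
  | succ m ih =>
    have hproj : m + 1 ≤ (X.image (Fin.removeNth 0)).card := ih (hX.image _) fun i => by
      obtain ⟨x, hx, hx'⟩ := h (Fin.succAbove 0 i)
      refine ⟨_, Finset.mem_image_of_mem _ hx, Finset.mem_image.2 ⟨_, hx', ?_⟩⟩
      exact Fin.removeNth_update_succAbove 0 i _ x
    have hlt : (X.image (Fin.removeNth 0)).card < X.card := by
      refine Finset.card_image_le.lt_of_ne fun hcard => ?_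
      obtain ⟨x, hx, hx'⟩ := h 0
      have := Finset.card_image_iff.1 hcard hx hx' (by simp)
      simpa using congrFun this 0
    omega

/-- A special case of Bondy's theorem on induced subsets. -/
theorem exists_injOn_removeNth (hX : X.card ≤ m + 1) :
    ∃ i : Fin (m + 1), Set.InjOn i.removeNth (X : Set (Fin (m + 1) → Bool)) := by
  obtain rfl | hne := X.eq_empty_or_nonempty
  · exact ⟨0, by simp⟩
  by_contra! h
  refine (succ_le_card_of_forall_update_mem hne fun i => ?_).not_gt (Nat.lt_succ_of_le hX)
  have hi := h i
  simp only [Set.InjOn, not_forall] at hi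
  obtain ⟨x, hx, y, hy, hxy, hne⟩ := hi
  exact ⟨x, hx, eq_update_of_removeNth_eq hne hxy ▸ hy⟩

/-- The part of `Y` in the facet `x i = b`, as a set of vertices of the `m`-cube. -/
def side (Y : Finset (Fin (m + 1) → Bool)) (i : Fin (m + 1)) (b : Bool) : Finset (Fin m → Bool) :=
  (Y.filter fun x => x i = b).image i.removeNth

@[simp]
theorem mem_side {z : Fin m → Bool} : z ∈ side Y i b ↔ facet i b z ∈ Y := by
  simp only [side, Finset.mem_image, Finset.mem_filter]
  constructor
  · rintro ⟨x, ⟨hx, hxb⟩, rfl⟩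
    rwa [facet_removeNth_of_eq hxb]
  · exact fun hz => ⟨_, ⟨hz, facet_apply_self z⟩, removeNth_facet z⟩

theorem card_side_le : (side Y i b).card ≤ (Y.filter fun x => x i = b).card :=
  Finset.card_image_le

theorem card_side_add_card_side_le : (side Y i b).card + (side Y i (!b)).card ≤ Y.card := by
  have hnot : (Y.filter fun x => x i = !b) = Y.filter fun x => ¬ x i = b :=
    Finset.filter_congr fun x _ => Bool.eq_not
  rw [← Finset.card_filter_add_card_filter_not (s := Y) (fun x => x i = b), ← hnot]
  exact add_le_add card_side_le card_side_le

theorem reachableIn_of_side (hx : x i = b) (hy : y i = b) (h : ReachableIn (cubeGraph m)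
      (side Y i b : Set (Fin m → Bool))ᶜ (i.removeNth x) (i.removeNth y)) :
    ReachableIn (cubeGraph (m + 1)) (Y : Set (Fin (m + 1) → Bool))ᶜ x y := by
  have := h.map (facet i b) (D' := (Y : Set (Fin (m + 1) → Bool))ᶜ) fun z (hz : z ∉ side Y i b) =>
    by simpa using hz
  rwa [facet_removeNth_of_eq hx, facet_removeNth_of_eq hy] at this

theorem eq_apply_or_eq_apply (hxy : x i ≠ y i) (b : Bool) : b = x i ∨ b = y i :=
  have two_values : ∀ a b c : Bool, a ≠ c → b = a ∨ b = c := by decide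
  two_values _ _ _ hxy

theorem reachableIn_of_card_side_lt (hm : IsVertexConnected (cubeGraph m) m) (hx : x ∉ Y)
    (hy : y ∉ Y) (hxy : x i = y i) (hside : (side Y i (y i)).card < m) :
    ReachableIn (cubeGraph (m + 1)) (Y : Set (Fin (m + 1) → Bool))ᶜ x y :=
  reachableIn_of_side hxy rfl <| hm hside _ (by rwa [mem_side, facet_removeNth_of_eq hxy])
    _ (by rwa [mem_side, facet_removeNth_of_eq rfl])

theorem reachableIn_of_update_notMem (hm : IsVertexConnected (cubeGraph m) m) (hx : x ∉ Y)
    (hy : y ∉ Y) (hxy : Function.update x i (y i) ∉ Y) (hside : (side Y i (y i)).card < m) :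
    ReachableIn (cubeGraph (m + 1)) (Y : Set (Fin (m + 1) → Bool))ᶜ x y :=
  (reachableIn_update hx hxy).trans (reachableIn_of_card_side_lt hm hxy hy (by simp) hside)

theorem exists_forall_facet_notMem (hY : Y.card < 2 ^ m) (i : Fin (m + 1)) :
    ∃ z, ∀ b, facet i b z ∉ Y := by
  have hcard : (side Y i true ∪ side Y i false).card < Fintype.card (Fin m → Bool) :=
    ((Finset.card_union_le _ _).trans card_side_add_card_side_le).trans_lt (by simpa using hY)
  obtain ⟨z, -, hz⟩ := Finset.exists_mem_notMem_of_card_lt_card hcard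
  simp only [Finset.mem_union, mem_side, not_or] at hz
  exact ⟨z, Bool.forall_bool.2 hz.symm⟩

theorem reachableIn_of_forall_card_side_lt (hm : IsVertexConnected (cubeGraph m) m) (hx : x ∉ Y)
    (hy : y ∉ Y) (hside : ∀ b, (side Y i b).card < m) (hY : Y.card < 2 ^ m) :
    ReachableIn (cubeGraph (m + 1)) (Y : Set (Fin (m + 1) → Bool))ᶜ x y := by
  obtain ⟨z, hz⟩ := exists_forall_facet_notMem hY i
  have hupdate : Function.update (facet i (x i) z) i (y i) = facet i (y i) z := by
    rw [← facet_removeNth, removeNth_facet]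
  exact (reachableIn_of_card_side_lt hm hx (hz (x i)) (by simp) (hside _)).trans
    (reachableIn_of_update_notMem hm (hz (x i)) hy (hupdate ▸ hz (y i)) (hside _))

theorem isVertexConnected (m : ℕ) : IsVertexConnected (cubeGraph m) m := by
  induction m with
  | zero => exact fun Y hY => absurd hY (Nat.not_lt_zero _)
  | succ m ih =>
    intro Y hY x hx y hy
    obtain rfl | hxy := eq_or_ne x y
    · exact .refl hx
    obtain rfl | hm := m.eq_zero_or_pos
    · exact .of_adj ⟨0, eq_update_of_removeNth_eq hxy (Subsingleton.elim _ _)⟩ hx hy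
    obtain ⟨i, hi⟩ := Function.ne_iff.1 hxy
    by_cases hb : ∃ b, side Y i b = ∅
    · obtain ⟨b, hb⟩ := hb
      have hupdate : ∀ x, Function.update x i b ∉ Y := fun x hx => by
        rw [← facet_removeNth, ← mem_side, hb] at hx
        exact Finset.notMem_empty _ hx
      obtain rfl | rfl : b = x i ∨ b = y i := eq_apply_or_eq_apply hi b
      · exact (reachableIn_of_update_notMem ih hy hx (hupdate y) (by simpa [hb])).symm
      · exact reachableIn_of_update_notMem ih hx hy (hupdate x) (by simpa [hb])
    · push Not at hb
      refine reachableIn_of_forall_card_side_lt (i := i) ih hx hy (fun b => ?_)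
        ((Nat.le_of_lt_succ hY).trans_lt Nat.lt_two_pow_self)
      have := card_side_add_card_side_le (Y := Y) (i := i) (b := b)
      have := (hb (!b)).card_pos
      omega

theorem reachableIn_of_exists_adj_of_card_side_le_one (hm : 2 ≤ m) (hx : x ∉ Y) (hy : y ∉ Y)
    (hxn : ∃ n ∉ Y, (cubeGraph (m + 1)).Adj x n) (hxy : x i ≠ y i)
    (hside : (side Y i (y i)).card ≤ 1) :
    ReachableIn (cubeGraph (m + 1)) (Y : Set (Fin (m + 1) → Bool))ᶜ x y := by
  have hlt : (side Y i (y i)).card < m := by omega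
  by_cases hx' : Function.update x i (y i) ∈ Y
  · obtain ⟨n, hn, hadj⟩ := hxn
    refine (reachableIn_of_update_notMem (isVertexConnected m) hn hy (fun hn' => ?_) hlt).head
      hadj hx
    rw [← facet_removeNth, ← mem_side] at hx' hn'
    have heq : i.removeNth x = i.removeNth n := Finset.card_le_one.1 hside _ hx' _ hn'
    have hni : n i = y i := by
      rw [eq_update_of_removeNth_eq hadj.ne heq, Function.update_self, Bool.not_eq.2 hxy]
    rw [heq, mem_side, facet_removeNth_of_eq hni] at hx'
    exact hn hx'
  · exact reachableIn_of_update_notMem (isVertexConnected m) hx hy hx' hlt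

theorem reachableIn_compl_of_exists_adj (hm : 2 ≤ m) (hY : Y.card ≤ m + 1) (hx : x ∉ Y)
    (hy : y ∉ Y) (hxn : ∃ n ∉ Y, (cubeGraph (m + 1)).Adj x n)
    (hyn : ∃ n ∉ Y, (cubeGraph (m + 1)).Adj y n) :
    ReachableIn (cubeGraph (m + 1)) (Y : Set (Fin (m + 1) → Bool))ᶜ x y := by
  obtain rfl | hxy := eq_or_ne x y
  · exact .refl hx
  obtain ⟨i, hi⟩ := Function.ne_iff.1 hxy
  by_cases hb : ∃ b, (side Y i b).card ≤ 1
  · obtain ⟨b, hb⟩ := hb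
    obtain rfl | rfl : b = x i ∨ b = y i := eq_apply_or_eq_apply hi b
    · exact (reachableIn_of_exists_adj_of_card_side_le_one hm hy hx hyn hi.symm hb).symm
    · exact reachableIn_of_exists_adj_of_card_side_le_one hm hx hy hxn hi hb
  · push Not at hb
    have hpow : m + 1 < 2 ^ m := by
      obtain ⟨k, rfl⟩ := Nat.exists_eq_add_of_le hm
      have : k < 2 ^ k := Nat.lt_two_pow_self
      rw [pow_add]
      omega
    refine reachableIn_of_forall_card_side_lt (i := i) (isVertexConnected m) hx hy (fun b => ?_)
      (hY.trans_lt hpow)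
    have := card_side_add_card_side_le (Y := Y) (i := i) (b := b)
    have := hb (!b)
    omega

theorem exists_adj_notMem_side {O : Finset (Fin (m + 1) → Bool)} (hO : O.card ≤ m)
    (hparity : ∃ u ∈ O, ∃ v ∈ O, parity (m + 1) u ≠ parity (m + 1) v) (z : Fin m → Bool) :
    ∃ n ∉ side O i b, (cubeGraph m).Adj z n := by
  classical
  by_contra! h
  have hsub : ((cubeGraph m).neighborFinset z).image (facet i b) ⊆ O := by
    refine Finset.image_subset_iff.2 fun n hn => ?_
    by_contra hnO
    exact h n (by rwa [mem_side]) (by simpa using hn)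
  have hinj : Function.Injective (facet i b) := fun u v huv => by
    simpa using congrArg i.removeNth huv
  have himage := Finset.eq_of_subset_of_card_le hsub <| by
    rwa [Finset.card_image_of_injective _ hinj, card_neighborFinset]
  have hadj : ∀ u ∈ O, (cubeGraph (m + 1)).Adj u (facet i b z) := fun u hu => by
    obtain ⟨n, hn, rfl⟩ := Finset.mem_image.1 (himage ▸ hu)
    exact (facet i b).map_adj (by simpa using hn : (cubeGraph m).Adj z n).symm
  obtain ⟨u, hu, v, hv, huv⟩ := hparity
  exact huv (parity_eq_of_adj_of_adj (hadj u hu) (hadj v hv))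

theorem reachableIn_compl_side {O : Finset (Fin (m + 1) → Bool)} (hm : 3 ≤ m) (hO : O.card ≤ m)
    (h : (side O i b).card < m ∨ ∃ u ∈ O, ∃ v ∈ O, parity (m + 1) u ≠ parity (m + 1) v)
    {u v : Fin m → Bool} (hu : u ∉ side O i b) (hv : v ∉ side O i b) :
    ReachableIn (cubeGraph m) (side O i b : Set (Fin m → Bool))ᶜ u v := by
  obtain hlt | hparity := h
  · exact isVertexConnected m hlt u hu v hv
  · obtain ⟨m, rfl⟩ := Nat.exists_eq_succ_of_ne_zero (show m ≠ 0 by omega)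
    exact reachableIn_compl_of_exists_adj (by omega)
      (card_side_le.trans ((Finset.card_filter_le _ _).trans hO)) hu hv
      (exists_adj_notMem_side hO hparity u) (exists_adj_notMem_side hO hparity v)

theorem injOn_removeNth_of_parity_eq (h : ∀ u ∈ X, ∀ v ∈ X, parity (m + 1) u = parity (m + 1) v)
    (i : Fin (m + 1)) : Set.InjOn i.removeNth (X : Set (Fin (m + 1) → Bool)) := by
  intro u hu v hv huv
  by_contra hne
  exact (parity (m + 1)).valid (show (cubeGraph (m + 1)).Adj u v from
    ⟨i, eq_update_of_removeNth_eq hne huv⟩) (h u hu v hv)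

variable {ι : Type*} {s t : ι → Fin (m + 1) → Bool} {F O : Finset (Fin (m + 1) → Bool)}

theorem card_sdiff_pair (hst : Function.Injective (Sum.elim s t)) (hs : ∀ j, s j ∈ X)
    (ht : ∀ j, t j ∈ X) (a : ι) : (X \ {s a, t a}).card + 2 = X.card := by
  have hne : s a ≠ t a := hst.ne (a₁ := .inl a) (a₂ := .inr a) Sum.inl_ne_inr
  rw [← Finset.card_pair hne, Finset.card_sdiff_add_card_eq_card]
  simp [Finset.insert_subset_iff, hs, ht]

/-- If no set `X \ {s a, t a}` has two parities, then neither has `X`, as two of these sets meet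
and together cover `X`. -/
theorem parity_eq_of_forall_sdiff [Nontrivial ι] (hX : 5 ≤ X.card)
    (hst : Function.Injective (Sum.elim s t))
    (h : ∀ a, ∀ u ∈ X \ {s a, t a}, ∀ v ∈ X \ {s a, t a}, parity (m + 1) u = parity (m + 1) v) :
    ∀ u ∈ X, ∀ v ∈ X, parity (m + 1) u = parity (m + 1) v := by
  obtain ⟨a, c, hac⟩ := exists_pair_ne ι
  obtain ⟨w, hwX, hw⟩ := Finset.exists_mem_notMem_of_card_lt_card
    (Finset.card_le_four (a := s a) (b := t a) (c := s c) (d := t c) |>.trans_lt hX)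
  simp only [Finset.mem_insert, Finset.mem_singleton, not_or] at hw
  have key : ∀ u ∈ X, parity (m + 1) u = parity (m + 1) w := fun u hu => by
    by_cases hua : u = s a ∨ u = t a
    · refine h c u ?_ w (by simp [hwX, hw])
      have := hst.ne (a₁ := .inl a) (a₂ := .inl c)
      have := hst.ne (a₁ := .inr a) (a₂ := .inr c)
      have := hst.ne (a₁ := .inl a) (a₂ := .inr c)
      have := hst.ne (a₁ := .inr a) (a₂ := .inl c)
      obtain rfl | rfl := hua <;> simp_all
    · exact h a u (by simpa [hu] using hua) w (by simp [hwX, hw])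
  exact fun u hu v hv => (key u hu).trans (key v hv).symm

theorem exists_injOn_removeNth_erase [Nontrivial ι] (hm : 3 ≤ m) (hX : X.card ≤ m + 2)
    (hst : Function.Injective (Sum.elim s t)) (hs : ∀ j, s j ∈ X) (ht : ∀ j, t j ∈ X) :
    ∃ (a : ι) (i : Fin (m + 1)),
      Set.InjOn i.removeNth (X.erase (s a) : Set (Fin (m + 1) → Bool)) ∧
      ((side (X \ {s a, t a}) i (s a i)).card < m ∨
        ∃ u ∈ X \ {s a, t a}, ∃ v ∈ X \ {s a, t a}, parity (m + 1) u ≠ parity (m + 1) v) := by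
  by_cases h : ∃ a, (X \ {s a, t a}).card < m ∨
      ∃ u ∈ X \ {s a, t a}, ∃ v ∈ X \ {s a, t a}, parity (m + 1) u ≠ parity (m + 1) v
  · obtain ⟨a, ha⟩ := h
    obtain ⟨i, hi⟩ := exists_injOn_removeNth (X := X.erase (s a)) (m := m) <| by
      rw [Finset.card_erase_of_mem (hs a)]
      omega
    exact ⟨a, i, hi, ha.imp_left fun hlt =>
      (card_side_le.trans (Finset.card_filter_le _ _)).trans_lt hlt⟩
  · push Not at h
    obtain ⟨a, c, hac⟩ := exists_pair_ne ι
    have hcard := card_sdiff_pair hst hs ht a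
    have hXcard : m + 2 ≤ X.card := by have := (h a).1; omega
    obtain ⟨i, hi⟩ := Function.ne_iff.1 <|
      hst.ne (a₁ := .inl c) (a₂ := .inl a) (by simpa using hac.symm)
    have hsc : s c ∈ X \ {s a, t a} := by
      have := hst.ne (a₁ := .inl c) (a₂ := .inl a)
      have := hst.ne (a₁ := .inl c) (a₂ := .inr a)
      simp_all [hac.symm]
    have hlt : ((X \ {s a, t a}).filter fun x => x i = s a i).card < (X \ {s a, t a}).card :=
      Finset.card_lt_card (Finset.filter_ssubset.2 ⟨s c, hsc, hi⟩)
    refine ⟨a, i, (injOn_removeNth_of_parity_eq ?_ i).mono (Finset.erase_subset _ _),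
      .inl (card_side_le.trans_lt (by omega))⟩
    exact parity_eq_of_forall_sdiff (by omega) hst fun a => (h a).2

/-- The other pairs are linked in the facet opposite to `s a`, to which each of their terminals is
moved along the direction `i`. -/
theorem linkable_compl_of_removeNth {a : ι} (hF : F ⊆ O) (hs : ∀ j ≠ a, s j ∈ O)
    (ht : ∀ j ≠ a, t j ∈ O) (hta : t a ∉ F)
    (ha : ReachableIn (cubeGraph m) (side O i (s a i) : Set (Fin m → Bool))ᶜ
      (i.removeNth (s a)) (i.removeNth (t a)))
    (h : Linkable (cubeGraph m)
      (insert (i.removeNth (t a)) (F.image i.removeNth) : Finset (Fin m → Bool))ᶜ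
      (fun j : {j // j ≠ a} => i.removeNth (s j)) fun j => i.removeNth (t j)) :
    Linkable (cubeGraph (m + 1)) (F : Set (Fin (m + 1) → Bool))ᶜ s t := by
  refine linkable_of_reachableIn (a := a) (B := {x | x = t a ∨ x i = s a i ∧ x ∉ O}) ?_ ?_ ?_
  · rintro x (rfl | ⟨-, hx⟩)
    exacts [hta, fun hxF => hx (hF hxF)]
  · have hfacet := ha.map (facet i (s a i)) (D' := {x | x = t a ∨ x i = s a i ∧ x ∉ O})
      fun z hz => .inr ⟨facet_apply_self z, by simpa using hz⟩
    rw [facet_removeNth_of_eq rfl, facet_removeNth] at hfacet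
    exact hfacet.trans (reachableIn_update (.inl rfl) hfacet.right_mem).symm
  obtain ⟨A, hAF, hA, hdisj⟩ := h
  let B : {j // j ≠ a} → Set (Fin (m + 1) → Bool) := fun j =>
    {x | i.removeNth x ∈ A j ∧ (x i = !(s a i) ∨ x = s j ∨ x = t j)}
  have hmove : ∀ (j : {j // j ≠ a}) (x : Fin (m + 1) → Bool), i.removeNth x ∈ A j →
      x = s j ∨ x = t j → ReachableIn (cubeGraph (m + 1)) (B j)
        x (facet i (!(s a i)) (i.removeNth x)) := fun j x hxA hx => by
    rw [facet_removeNth]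
    exact reachableIn_update ⟨hxA, .inr hx⟩ ⟨by simpa using hxA, .inl (by simp)⟩
  refine ⟨B, fun j x hx => ?_, fun j => ?_, fun j k hjk => ?_⟩
  · have hxF := hAF j hx.1
    simp only [Set.mem_compl_iff, Finset.mem_coe, Finset.mem_insert, not_or] at hxF
    refine ⟨fun hx' => hxF.2 (Finset.mem_image_of_mem _ hx'), ?_⟩
    rintro (rfl | ⟨hxi, hxO⟩)
    · exact hxF.1 rfl
    · obtain hx | rfl | rfl := hx.2
      · simp [hxi] at hx
      · exact hxO (hs j j.2)
      · exact hxO (ht j j.2)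
  · exact (hmove j (s j) (hA j).left_mem (.inl rfl)).trans <|
      ((hA j).map (facet i (!(s a i))) (D' := B j) fun z hz =>
        ⟨by simpa using hz, by simp⟩).trans
        (hmove j (t j) (hA j).right_mem (.inr rfl)).symm
  · exact Set.disjoint_left.2 fun x hxj hxk => Set.disjoint_left.1 (hdisj hjk) hxj.1 hxk.1

theorem removeNth_notMem_side {u v : Fin (m + 1) → Bool} (hv : v ∈ X) (hvu : v ≠ u)
    (hinj : Set.InjOn i.removeNth (X.erase u : Set (Fin (m + 1) → Bool))) :
    i.removeNth u ∉ side (X \ {u, v}) i (u i) ∧ i.removeNth v ∉ side (X \ {u, v}) i (u i) := by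
  refine ⟨by simp, fun h => ?_⟩
  rw [mem_side, Finset.mem_sdiff, Finset.mem_insert, Finset.mem_singleton, not_or] at h
  exact h.2.2 (hinj (Finset.mem_erase.2 ⟨h.2.1, h.1⟩) (Finset.mem_erase.2 ⟨hvu, hv⟩) (by simp))

theorem removeNth_terminals {a : ι} (hst : Function.Injective (Sum.elim s t))
    (hX : ∀ p, Sum.elim s t p ∈ X) (hFX : F ⊆ X) (hF : ∀ p, Sum.elim s t p ∉ F)
    (hinj : Set.InjOn i.removeNth (X.erase (s a) : Set (Fin (m + 1) → Bool))) :
    Function.Injective (Sum.elim (fun j : {j // j ≠ a} => i.removeNth (s j))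
      fun j : {j // j ≠ a} => i.removeNth (t j)) ∧
    ∀ p, Sum.elim (fun j : {j // j ≠ a} => i.removeNth (s j))
      (fun j : {j // j ≠ a} => i.removeNth (t j)) p ∉
        insert (i.removeNth (t a)) (F.image i.removeNth) := by
  have hcomp : Sum.elim (fun j : {j // j ≠ a} => i.removeNth (s j))
      (fun j : {j // j ≠ a} => i.removeNth (t j)) =
        fun p => i.removeNth (Sum.elim s t (p.map Subtype.val Subtype.val)) := by
    ext (j | j) : 1 <;> rfl
  have hmem : ∀ p, p ≠ .inl a → Sum.elim s t p ∈ X.erase (s a) := fun p hp =>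
    Finset.mem_erase.2 ⟨hst.ne (a₂ := .inl a) hp, hX p⟩
  have hval : ∀ p : {j // j ≠ a} ⊕ {j // j ≠ a},
      p.map Subtype.val Subtype.val ≠ .inl a ∧ p.map Subtype.val Subtype.val ≠ .inr a := by
    rintro (j | j) <;> simp [j.2]
  rw [hcomp]
  refine ⟨fun p q hpq => ?_, fun p => ?_⟩
  · have := hinj (hmem _ (hval p).1) (hmem _ (hval q).1) hpq
    exact (Subtype.val_injective.sumMap Subtype.val_injective) (hst this)
  · simp only [Finset.mem_insert, Finset.mem_image, not_or, not_exists, not_and]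
    refine ⟨fun hp => ?_, fun x hx hp => ?_⟩
    · exact (hval p).2 (hst (hinj (hmem _ (hval p).1) (hmem (.inr a) Sum.inr_ne_inl) hp))
    · have hxa : x ≠ s a := fun h => hF (.inl a) (show s a ∈ F from h ▸ hx)
      have := hinj (Finset.mem_erase.2 ⟨hxa, hFX hx⟩) (hmem _ (hval p).1) hp
      exact hF _ (this ▸ hx)

theorem linkable_compl_of_card_le_one {m : ℕ} {s t : ι → Fin m → Bool}
    {F : Finset (Fin m → Bool)} [Fintype ι] (hF : ∀ p, Sum.elim s t p ∉ F)
    (hcard : 2 * Fintype.card ι + F.card ≤ m + 1) (hι : Fintype.card ι ≤ 1) :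
    Linkable (cubeGraph m) (F : Set (Fin m → Bool))ᶜ s t :=
  have := Fintype.card_le_one_iff_subsingleton.1 hι
  linkable_of_subsingleton fun i =>
    have := Fintype.card_pos_iff.2 ⟨i⟩
    isVertexConnected m (by omega) _ (hF (.inl i)) _ (hF (.inr i))

theorem linkable_compl {m : ℕ} {s t : ι → Fin m → Bool} {F : Finset (Fin m → Bool)}
    [Fintype ι] (hst : Function.Injective (Sum.elim s t)) (hF : ∀ p, Sum.elim s t p ∉ F)
    (hcard : 2 * Fintype.card ι + F.card ≤ m + 1) (hm : 4 ≤ m ∨ Fintype.card ι ≤ 1) :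
    Linkable (cubeGraph m) (F : Set (Fin m → Bool))ᶜ s t := by
  classical
  induction m generalizing ι with
  | zero => exact linkable_compl_of_card_le_one hF hcard (by omega)
  | succ m ih =>
    obtain hι | hι := le_or_gt (Fintype.card ι) 1
    · exact linkable_compl_of_card_le_one hF hcard hι
    have := Fintype.one_lt_card_iff_nontrivial.1 hι
    let X := F ∪ Finset.univ.image (Sum.elim s t)
    have hX : X.card ≤ m + 2 := by
      refine (Finset.card_union_le _ _).trans ?_
      rw [Finset.card_image_of_injective _ hst, Finset.card_univ, Fintype.card_sum]
      omega
    have hterm : ∀ p, Sum.elim s t p ∈ X := fun p => by simp [X]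
    have hs : ∀ j, s j ∈ X := fun j => hterm (.inl j)
    have ht : ∀ j, t j ∈ X := fun j => hterm (.inr j)
    obtain ⟨a, i, hinj, hside⟩ := exists_injOn_removeNth_erase (by omega) hX hst hs ht
    have hne : t a ≠ s a := hst.ne (a₁ := .inr a) (a₂ := .inl a) Sum.inr_ne_inl
    have hO : ∀ p, p ≠ .inl a → p ≠ .inr a → Sum.elim s t p ∈ X \ {s a, t a} := fun p hpa hpa' => by
      simpa [hterm p] using
        And.intro (hst.ne (a₂ := .inl a) hpa) (hst.ne (a₂ := .inr a) hpa')
    have hFO : F ⊆ X \ {s a, t a} := Finset.subset_sdiff.2 ⟨Finset.subset_union_left,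
      Finset.disjoint_right.2 (by simpa using ⟨hF (.inl a), hF (.inr a)⟩)⟩
    obtain ⟨hsa, hta⟩ := removeNth_notMem_side (ht a) hne hinj
    obtain ⟨hst', hF'⟩ := removeNth_terminals hst hterm Finset.subset_union_left hF hinj
    have hO_card := card_sdiff_pair hst hs ht a
    have hι' : Fintype.card {j // j ≠ a} = Fintype.card ι - 1 := Set.card_ne_eq a
    have hF_card := (Finset.card_insert_le (i.removeNth (t a)) (F.image i.removeNth)).trans
      (Nat.succ_le_succ Finset.card_image_le)
    exact linkable_compl_of_removeNth hFO (fun j hj => hO (.inl j) (by simpa) (by simp))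
      (fun j hj => hO (.inr j) (by simp) (by simpa)) (hF (.inr a))
      (reachableIn_compl_side (by omega) (by omega) hside hsa hta)
      (ih hst' hF' (by omega) (by omega))

end cubeGraph

end Cube

namespace Polytope

section Faces

variable {E : Type*} [AddCommGroup E] [Module ℝ E] {S T U P F G : Set E} {u v w x y : E}

theorem convexHull_inter_of_isExtreme (hF : IsExtreme ℝ (convexHull ℝ S) F) (hconv : Convex ℝ F) :
    convexHull ℝ (S ∩ F) = F := by
  refine (convexHull_min Set.inter_subset_right hconv).antisymm fun x hx => ?_
  have hdiff : convexHull ℝ (S \ F) ⊆ convexHull ℝ S \ F :=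
    convexHull_min (Set.sdiff_subset_sdiff_left (subset_convexHull ℝ S))
      (hF.convex_sdiff (convex_convexHull ℝ S))
  have hxS : x ∈ convexHull ℝ (S ∩ F ∪ S \ F) := by
    rw [Set.inter_union_sdiff]
    exact hF.subset hx
  obtain h | hne := (S \ F).eq_empty_or_nonempty
  · rwa [h, Set.union_empty] at hxS
  obtain h | hne' := (S ∩ F).eq_empty_or_nonempty
  · rw [h, Set.empty_union] at hxS
    exact ((hdiff hxS).2 hx).elim
  rw [convexHull_union hne' hne, mem_convexJoin] at hxS
  obtain ⟨a, ha, b, hb, hxab⟩ := hxS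
  rw [← insert_endpoints_openSegment] at hxab
  obtain rfl | rfl | hxab := hxab
  · exact ha
  · exact ((hdiff hb).2 hx).elim
  · exact ((hdiff hb).2 (hF.right_mem_of_mem_openSegment
      (convexHull_mono Set.inter_subset_left ha) (hdiff hb).1 hx hxab)).elim

variable [TopologicalSpace E] {ℓ g : StrongDual ℝ E}

theorem apply_eq_of_mem_toExposed (hx : x ∈ ℓ.toExposed S) (hy : y ∈ ℓ.toExposed S) :
    ℓ x = ℓ y :=
  (hy.2 x hx.1).antisymm (hx.2 y hy.1)

theorem apply_lt_of_notMem_toExposed (hx : x ∈ S) (hxℓ : x ∉ ℓ.toExposed S)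
    (hy : y ∈ ℓ.toExposed S) : ℓ x < ℓ y :=
  lt_of_not_ge fun h => hxℓ ⟨hx, fun z hz => (hy.2 z hz).trans h⟩

theorem toExposed_convexHull (S : Set E) (ℓ : StrongDual ℝ E) :
    ℓ.toExposed (convexHull ℝ S) = convexHull ℝ (ℓ.toExposed S) := by
  have hF : IsExposed ℝ (convexHull ℝ S) (ℓ.toExposed (convexHull ℝ S)) :=
    ContinuousLinearMap.toExposed.isExposed
  rw [← convexHull_inter_of_isExtreme hF.isExtreme (hF.convex (convex_convexHull ℝ S))]
  congr 1
  ext x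
  refine ⟨fun hx => ⟨hx.1, fun y hy => hx.2.2 y (subset_convexHull ℝ S hy)⟩,
    fun hx => ⟨hx.1, subset_convexHull ℝ S hx.1, fun y hy => ?_⟩⟩
  exact convexHull_min (t := {z | ℓ z ≤ ℓ x}) hx.2
    (convex_halfSpace_le ℓ.toLinearMap.isLinear (ℓ x)) hy

theorem isExposed_convexHull (hT : IsExposed ℝ S T) :
    IsExposed ℝ (convexHull ℝ S) (convexHull ℝ T) := by
  intro hne
  obtain ⟨ℓ, rfl⟩ := hT (convexHull_nonempty_iff.1 hne)
  exact ⟨ℓ, (toExposed_convexHull S ℓ).symm⟩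

/-- On a finite set, adding a small multiple of `g` to `ℓ` breaks the ties of `ℓ` according to `g`
and changes nothing else. -/
theorem exists_forall_le_iff_toLex_le (hS : S.Finite) (ℓ g : StrongDual ℝ E) :
    ∃ f : StrongDual ℝ E, ∀ u ∈ S, ∀ v ∈ S, f u ≤ f v ↔ toLex (ℓ u, g u) ≤ toLex (ℓ v, g v) := by
  obtain ⟨N, hN⟩ := ((hS.prod hS).image fun p => (g p.1 - g p.2) / (ℓ p.2 - ℓ p.1)).bddAbove
  have hlt : ∀ u ∈ S, ∀ v ∈ S, ℓ u < ℓ v → (N + 1) * ℓ u + g u < (N + 1) * ℓ v + g v := by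
    intro u hu v hv huv
    have := (div_le_iff₀ (sub_pos.2 huv)).1 (hN ⟨(u, v), ⟨hu, hv⟩, rfl⟩)
    linarith
  refine ⟨(N + 1) • ℓ + g, fun u hu v hv => ?_⟩
  rw [Prod.Lex.toLex_le_toLex]
  obtain h | h | h := lt_trichotomy (ℓ u) (ℓ v)
  · simp [h, (hlt u hu v hv h).le]
  · simp [h]
  · simp [h.not_gt, h.ne', hlt v hv u hu h]

theorem isExposed_trans_of_finite (hS : S.Finite) (hT : IsExposed ℝ S T) (hU : IsExposed ℝ T U) :
    IsExposed ℝ S U := by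
  intro hne
  obtain ⟨ℓ, rfl⟩ := hT (hne.mono hU.subset)
  obtain ⟨g, rfl⟩ := hU hne
  obtain ⟨f, hf⟩ := exists_forall_le_iff_toLex_le hS ℓ g
  refine ⟨f, ?_⟩
  ext x
  simp only [Prod.Lex.toLex_le_toLex] at hf
  constructor
  · rintro ⟨⟨hx, hxℓ⟩, hxg⟩
    refine ⟨hx, fun y hy => (hf y hy x hx).2 ?_⟩
    exact (hxℓ y hy).lt_or_eq.imp_right fun h => ⟨h, hxg y ⟨hy, fun z hz => h ▸ hxℓ z hz⟩⟩
  · rintro ⟨hx, hxf⟩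
    have hxℓ : ∀ y ∈ S, ℓ y < ℓ x ∨ ℓ y = ℓ x ∧ g y ≤ g x := fun y hy => (hf y hy x hx).1 (hxf y hy)
    exact ⟨⟨hx, fun y hy => (hxℓ y hy).elim le_of_lt fun h => h.1.le⟩,
      fun y hy => ((hxℓ y hy.1).resolve_left (hy.2 x hx).not_gt).2⟩

theorem IsPolytope.isExposed_trans (hP : IsPolytope P) (hF : IsExposed ℝ P F)
    (hG : IsExposed ℝ F G) : IsExposed ℝ P G := by
  intro hne
  obtain ⟨S, rfl⟩ := hP
  obtain ⟨ℓ, rfl⟩ := hF (hne.mono hG.subset)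
  obtain ⟨g, rfl⟩ := hG hne
  have hexp := isExposed_trans_of_finite S.finite_toSet
    (ContinuousLinearMap.toExposed.isExposed (l := ℓ))
    (ContinuousLinearMap.toExposed.isExposed (l := g))
  have := isExposed_convexHull hexp
  rw [← toExposed_convexHull, ← toExposed_convexHull] at this
  exact this hne

theorem IsPolytope.of_isExposed (hP : IsPolytope P) (hF : IsExposed ℝ P F) : IsPolytope F := by
  obtain rfl | hne := F.eq_empty_or_nonempty
  · exact ⟨∅, by simp⟩
  obtain ⟨S, rfl⟩ := hP
  obtain ⟨ℓ, rfl⟩ := hF hne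
  have hfin : (ℓ.toExposed (S : Set E)).Finite := S.finite_toSet.subset (Set.sep_subset _ _)
  refine ⟨hfin.toFinset, ?_⟩
  rw [hfin.coe_toFinset]
  exact toExposed_convexHull _ ℓ

theorem IsPolytope.finite_exposedPoints (hP : IsPolytope P) : (P.exposedPoints ℝ).Finite := by
  obtain ⟨S, rfl⟩ := hP
  exact S.finite_toSet.subset
    (exposedPoints_subset_extremePoints.trans extremePoints_convexHull_subset)

theorem mem_exposedPoints_of_subset (hST : S ⊆ T) (hxS : x ∈ S) (hx : x ∈ T.exposedPoints ℝ) :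
    x ∈ S.exposedPoints ℝ :=
  ⟨hxS, hx.2.imp fun _ hℓ y hy => hℓ y (hST hy)⟩

theorem exists_tilt (hS : S.Finite) (hv : v ∈ ℓ.toExposed S) (hg : ∀ u ∈ ℓ.toExposed S, g u = g v)
    (hw : w ∈ S) (hvw : g v < g w) :
    ∃ r > (0 : ℝ), ∃ y ∉ ℓ.toExposed S,
      insert y (ℓ.toExposed S) ⊆ (g + r • ℓ).toExposed S := by
  have hpos : ∀ u ∈ S \ ℓ.toExposed S, 0 < ℓ v - ℓ u := fun u hu =>
    sub_pos.2 (apply_lt_of_notMem_toExposed hu.1 hu.2 hv)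
  have hw' : w ∈ S \ ℓ.toExposed S := ⟨hw, fun h => hvw.ne' (hg w h)⟩
  obtain ⟨y, hy, hmax⟩ := Set.exists_max_image (S \ ℓ.toExposed S)
    (fun u => (g u - g v) / (ℓ v - ℓ u)) hS.sdiff ⟨w, hw'⟩
  set r := (g y - g v) / (ℓ v - ℓ y) with hr
  have hy_eq : (g + r • ℓ) y = (g + r • ℓ) v := by
    have := div_mul_cancel₀ (g y - g v) (hpos y hy).ne'
    rw [← hr] at this
    simp only [add_apply, smul_apply, smul_eq_mul]
    linarith
  have hface_eq : ∀ u ∈ ℓ.toExposed S, (g + r • ℓ) u = (g + r • ℓ) v := fun u hu => by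
    simp [hg u hu, apply_eq_of_mem_toExposed hu hv]
  have hle : ∀ u ∈ S, (g + r • ℓ) u ≤ (g + r • ℓ) v := fun u hu => by
    by_cases hu' : u ∈ ℓ.toExposed S
    · exact (hface_eq u hu').le
    · have := (div_le_iff₀ (hpos u ⟨hu, hu'⟩)).1 (hmax u ⟨hu, hu'⟩)
      simp only [add_apply, smul_apply, smul_eq_mul]
      linarith
  refine ⟨r, (div_pos (sub_pos.2 hvw) (hpos w hw')).trans_le (hmax w hw'), y, hy.2, ?_⟩
  rintro u (rfl | hu)
  · exact ⟨hy.1, fun z hz => (hle z hz).trans_eq hy_eq.symm⟩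
  · exact ⟨hu.1, fun z hz => (hle z hz).trans_eq (hface_eq u hu).symm⟩

theorem exists_toExposed_eq_singleton (hx : x ∈ S.exposedPoints ℝ) :
    ∃ ℓ : StrongDual ℝ E, ℓ.toExposed S = {x} :=
  (mem_exposedPoints_iff_exposed_singleton.1 hx (Set.singleton_nonempty x)).imp fun _ h => h.symm

/-- If the functionals exposing two further points `u` and `w` are tilted about `v` along the
functional `ℓ` exposing `v`, they become constant on `S`, so that `ℓ u < ℓ w` and `ℓ w < ℓ u`. -/
theorem eq_of_forall_isExposed_eq (hS : S.Finite) (hexp : S ⊆ S.exposedPoints ℝ) (hv : v ∈ S)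
    (h : ∀ T, IsExposed ℝ S T → v ∈ T → T ≠ {v} → T = S) (hu : u ∈ S) (hw : w ∈ S) (huv : u ≠ v)
    (hwv : w ≠ v) : u = w := by
  obtain ⟨ℓ, hℓ⟩ := exists_toExposed_eq_singleton (hexp hv)
  have hlt : ∀ u ∈ S, ∀ w ∈ S, u ≠ v → w ≠ u → ℓ u < ℓ w := by
    intro u hu w hw huv hwu
    obtain ⟨g, hg⟩ := exists_toExposed_eq_singleton (hexp hu)
    have hg_lt : ∀ z ∈ S, z ≠ u → g z < g u := fun z hz hzu =>
      apply_lt_of_notMem_toExposed hz (hg ▸ hzu) (hg ▸ rfl)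
    obtain ⟨r, hr, y, hyv, hsub⟩ := exists_tilt (ℓ := ℓ) (g := g) hS (hℓ.ge rfl)
      (by simp [hℓ]) hu (hg_lt v hv huv.symm)
    rw [hℓ] at hsub hyv
    have hface := h _ (ContinuousLinearMap.toExposed.isExposed (l := g + r • ℓ))
      (hsub (.inr rfl)) fun h => hyv (h ▸ hsub (.inl rfl))
    have huw := apply_eq_of_mem_toExposed (hface.ge hu) (hface.ge hw)
    have := hg_lt w hw hwu
    simp only [add_apply, smul_apply, smul_eq_mul] at huw
    exact lt_of_mul_lt_mul_left (by linarith) hr.le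
  by_contra huw
  exact lt_asymm (hlt u hu w hw huv (Ne.symm huw)) (hlt w hw u hu hwv huw)

theorem lt_of_forall_isExposed_eq (hS : S.Finite) (hv : v ∈ S.exposedPoints ℝ)
    (f : StrongDual ℝ E) (h : ∀ T, IsExposed ℝ S T → v ∈ T → (∃ u ∈ T, f v < f u) → T = S)
    (hw : w ∈ S) (hvw : f v < f w) (hu : u ∈ S) (huv : u ≠ v) : f v < f u := by
  obtain ⟨ℓ, hℓ⟩ := exists_toExposed_eq_singleton hv
  obtain ⟨r, hr, y, hyv, hsub⟩ := exists_tilt (ℓ := ℓ) hS (hℓ.ge rfl) (by simp [hℓ]) hw hvw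
  rw [hℓ] at hsub hyv
  have hf_lt : ∀ u ∈ (f + r • ℓ).toExposed S, u ≠ v → f v < f u := fun u hu huv => by
    have hℓ_lt : ℓ u < ℓ v := apply_lt_of_notMem_toExposed hu.1 (hℓ ▸ huv) (hℓ.ge rfl)
    have heq := apply_eq_of_mem_toExposed hu (hsub (.inr rfl))
    simp only [add_apply, smul_apply, smul_eq_mul] at heq
    linarith [mul_lt_mul_of_pos_left hℓ_lt hr]
  have hface := h _ (ContinuousLinearMap.toExposed.isExposed (l := f + r • ℓ)) (hsub (.inr rfl))
    ⟨y, hsub (.inl rfl), hf_lt y (hsub (.inl rfl)) hyv⟩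
  exact hf_lt u (hface.ge hu) huv

/-- The edge is a minimal face among those containing `v` and a point where `f` is larger. -/
theorem exists_isExposed_pair (hS : S.Finite) (hexp : S ⊆ S.exposedPoints ℝ)
    (f : StrongDual ℝ E) (hv : v ∈ S) (hw : w ∈ S) (hvw : f v < f w) :
    ∃ y ∈ S, f v < f y ∧ IsExposed ℝ S {v, y} := by
  obtain ⟨T, ⟨hT, hvT, w, hwT, hvw⟩, hmin⟩ := Set.Finite.exists_minimal
    (s := {T | IsExposed ℝ S T ∧ v ∈ T ∧ ∃ w ∈ T, f v < f w})
    (hS.finite_subsets.subset fun T hT => hT.1.subset) ⟨S, .refl S, hv, w, hw, hvw⟩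
  have hTfin := hS.subset hT.subset
  have hTexp : T ⊆ T.exposedPoints ℝ := fun x hx =>
    mem_exposedPoints_of_subset hT.subset hx (hexp (hT.subset hx))
  have hface : ∀ U, IsExposed ℝ T U → v ∈ U → (∃ u ∈ U, f v < f u) → U = T := fun U hU hvU hlt =>
    hU.subset.antisymm (hmin ⟨isExposed_trans_of_finite hS hT hU, hvU, hlt⟩ hU.subset)
  have hwv : w ≠ v := fun h => hvw.ne' (congrArg f h)
  have hT_eq : T = {v, w} := by
    refine Set.Subset.antisymm (fun u hu => or_iff_not_imp_left.2 fun huv => ?_)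
      (Set.pair_subset hvT hwT)
    refine eq_of_forall_isExposed_eq hTfin hTexp hvT (fun U hU hvU hne => ?_) hu hwT huv hwv
    obtain ⟨z, hz, hzv⟩ := ((Set.nontrivial_iff_ne_singleton hvU).2 hne).exists_ne v
    exact hface U hU hvU
      ⟨z, hz, lt_of_forall_isExposed_eq hTfin (hTexp hvT) f hface hwT hvw (hU.subset hz) hzv⟩
  exact ⟨w, hT.subset hwT, hvw, hT_eq ▸ hT⟩

end Faces

section VectorSpan

variable {E : Type*} [AddCommGroup E] [Module ℝ E] {S T : Set E} {u v x : E}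

theorem dim_convexHull (S : Set E) : dim (convexHull ℝ S) = Module.finrank ℝ (vectorSpan ℝ S) := by
  rw [dim, ← direction_affineSpan, affineSpan_convexHull, direction_affineSpan]

theorem finrank_vectorSpan_lt_card (T : Finset E) (hT : T.Nonempty) :
    Module.finrank ℝ (vectorSpan ℝ (T : Set E)) < T.card := by
  classical
  have hpos := hT.card_pos
  have hle := finrank_vectorSpan_image_finset_le ℝ id T (n := T.card - 1) (by omega)
  rw [Finset.image_id] at hle
  omega

theorem vectorSpan_le_ker_iff (f : E →ₗ[ℝ] ℝ) :
    vectorSpan ℝ T ≤ LinearMap.ker f ↔ ∀ x ∈ T, ∀ y ∈ T, f x = f y := by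
  simp only [vectorSpan_def, Submodule.span_le, Set.vsub_subset_iff, vsub_eq_sub, SetLike.mem_coe,
    LinearMap.mem_ker, map_sub, sub_eq_zero]

theorem exists_apply_lt_apply_average {V : Finset E} (f : E →ₗ[ℝ] ℝ) (hx : x ∈ V)
    (hlt : f ((V.card : ℝ)⁻¹ • ∑ u ∈ V, u) < f x) :
    ∃ u ∈ V, f u < f ((V.card : ℝ)⁻¹ • ∑ u ∈ V, u) := by
  by_contra! hle
  have hcard : (V.card : ℝ) ≠ 0 := Nat.cast_ne_zero.2 (Finset.card_ne_zero_of_mem hx)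
  refine (Finset.sum_lt_sum hle ⟨x, hx, hlt⟩).ne ?_
  rw [Finset.sum_const, nsmul_eq_mul, map_smul, map_sum, smul_eq_mul, mul_inv_cancel_left₀ hcard]

variable [TopologicalSpace E]

theorem exists_strongDual_vanishing_of_notMem [SeparatingDual ℝ E] {W : Submodule ℝ E}
    [FiniteDimensional ℝ W] (hx : x ∉ W) : ∃ f : StrongDual ℝ E, (∀ y ∈ W, f y = 0) ∧ f x ≠ 0 := by
  obtain ⟨f, hfx, hfW⟩ := Submodule.exists_le_ker_of_notMem hx
  let W' := W ⊔ Submodule.span ℝ {x}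
  obtain ⟨g, hg⟩ := SeparatingDual.dualMap_surjective_iff.2 W'.subtype_injective
    (f.comp W'.subtype)
  have hgf : ∀ y ∈ W', g y = f y := fun y hy => LinearMap.congr_fun hg ⟨y, hy⟩
  refine ⟨g, fun y hy => ?_, ?_⟩
  · rw [hgf y (Submodule.mem_sup_left hy)]
    exact hfW hy
  · rwa [hgf x (Submodule.mem_sup_right (Submodule.mem_span_singleton_self x))]

theorem exists_strongDual_const_on [SeparatingDual ℝ E] (hT : T.Finite)
    (h : ¬ vectorSpan ℝ S ≤ vectorSpan ℝ T) (hv : v ∈ T) :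
    ∃ f : StrongDual ℝ E, (∀ x ∈ T, f x = f v) ∧ ∃ w ∈ S, f v < f w := by
  have := finiteDimensional_vectorSpan_of_finite ℝ hT
  obtain ⟨z, hzS, hzT⟩ := SetLike.not_le_iff_exists.1 h
  obtain ⟨f, hfT, hfz⟩ := exists_strongDual_vanishing_of_notMem hzT
  have hconst : ∀ x ∈ T, f x = f v := fun x hx =>
    (vectorSpan_le_ker_iff (f : E →ₗ[ℝ] ℝ)).1 hfT x hx v hv
  obtain ⟨w, hw, hwv⟩ : ∃ w ∈ S, f w ≠ f v := by
    by_contra! hS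
    exact hfz ((vectorSpan_le_ker_iff (f : E →ₗ[ℝ] ℝ)).2
      (fun x hx y hy => (hS x hx).trans (hS y hy).symm) hzS)
  obtain hlt | hgt := hwv.lt_or_gt
  · exact ⟨-f, fun x hx => congrArg Neg.neg (hconst x hx), w, hw, neg_lt_neg hlt⟩
  · exact ⟨f, hconst, w, hw, hgt⟩

/-- Otherwise tilting `ℓ` along a functional constant on `insert u (ℓ.toExposed S)` yields a larger
proper face. -/
theorem vectorSpan_le_vectorSpan_insert_of_maximal [SeparatingDual ℝ E] {ℓ : StrongDual ℝ E}
    (hS : S.Finite) (hv : v ∈ ℓ.toExposed S) (hu : u ∈ S) (huℓ : u ∉ ℓ.toExposed S)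
    (hmax : ∀ F, IsExposed ℝ S F → ℓ.toExposed S ⊂ F → F = S) :
    vectorSpan ℝ S ≤ vectorSpan ℝ (insert u (ℓ.toExposed S)) := by
  by_contra hle
  obtain ⟨g, hg, w, hw, hvw⟩ := exists_strongDual_const_on
    ((hS.subset (Set.sep_subset _ _)).insert u) hle (Set.mem_insert_of_mem u hv)
  obtain ⟨r, hr, y, hyℓ, hsub⟩ := exists_tilt hS hv
    (fun z hz => hg z (Set.mem_insert_of_mem u hz)) hw hvw
  have hface : (g + r • ℓ).toExposed S = S :=
    hmax _ ContinuousLinearMap.toExposed.isExposed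
      ⟨(Set.subset_insert _ _).trans hsub, fun h => hyℓ (h (hsub (Set.mem_insert _ _)))⟩
  have huv := apply_eq_of_mem_toExposed (hface.ge hu) (hface.ge hv.1)
  have hlt := mul_lt_mul_of_pos_left (apply_lt_of_notMem_toExposed hu huℓ hv) hr
  simp only [add_apply, smul_apply, smul_eq_mul, hg u (Set.mem_insert u _)] at huv
  linarith

theorem exists_isExposed_finrank_vectorSpan_add_one [SeparatingDual ℝ E] (hS : S.Finite)
    (hSnt : S.Nontrivial) : ∃ F, IsExposed ℝ S F ∧ F.Nonempty ∧
      Module.finrank ℝ (vectorSpan ℝ F) + 1 = Module.finrank ℝ (vectorSpan ℝ S) := by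
  have hproper : ∃ F, IsExposed ℝ S F ∧ F.Nonempty ∧ F ≠ S := by
    obtain ⟨u, hu, v, hv, huv⟩ := hSnt
    obtain ⟨f, -, w, hw, hvw⟩ := exists_strongDual_const_on (S := S) (Set.finite_singleton v)
      (fun h => huv (by simpa [sub_eq_zero] using h (vsub_mem_vectorSpan ℝ hu hv)))
      (Set.mem_singleton v)
    obtain ⟨z, hz, hmax⟩ := Set.exists_max_image S f hS ⟨v, hv⟩
    exact ⟨f.toExposed S, ContinuousLinearMap.toExposed.isExposed, ⟨z, hz, hmax⟩,
      fun h => (hvw.trans_le ((h.ge hv).2 w hw)).false⟩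
  obtain ⟨F, ⟨hF, hFne, hFS⟩, hmax⟩ := Set.Finite.exists_maximal
    (s := {F | IsExposed ℝ S F ∧ F.Nonempty ∧ F ≠ S})
    (hS.finite_subsets.subset fun F hF => hF.1.subset) hproper
  obtain ⟨ℓ, rfl⟩ : ∃ ℓ : StrongDual ℝ E, F = ℓ.toExposed S := hF hFne
  obtain ⟨v, hv⟩ := hFne
  obtain ⟨u, hu, huF⟩ := Set.exists_of_ssubset (hF.subset.ssubset_of_ne hFS)
  refine ⟨_, hF, ⟨v, hv⟩, le_antisymm ?_ ?_⟩
  · have := finiteDimensional_vectorSpan_of_finite ℝ hS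
    refine Submodule.finrank_lt_finrank_of_lt
      ((vectorSpan_mono ℝ hF.subset).lt_of_not_ge fun hle => ?_)
    have hker : vectorSpan ℝ (ℓ.toExposed S) ≤ LinearMap.ker (ℓ : E →ₗ[ℝ] ℝ) :=
      (vectorSpan_le_ker_iff _).2 fun x hx y hy => apply_eq_of_mem_toExposed hx hy
    exact (apply_lt_of_notMem_toExposed hu huF hv).ne
      ((vectorSpan_le_ker_iff _).1 (hle.trans hker) u hu v hv.1)
  · have := finiteDimensional_vectorSpan_of_finite ℝ (hS.subset hF.subset)
    have hins := finiteDimensional_vectorSpan_of_finite ℝ ((hS.subset hF.subset).insert u)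
    refine (Submodule.finrank_mono (vectorSpan_le_vectorSpan_insert_of_maximal hS hv hu huF
      fun G hG hlt => ?_)).trans (finrank_vectorSpan_insert_le_set ℝ _ u)
    by_contra hGS
    exact hlt.not_subset (hmax ⟨hG, ⟨v, hlt.subset hv⟩, hGS⟩ hlt.subset)

end VectorSpan

section Vertices

variable {E : Type*} [AddCommGroup E] [Module ℝ E] [TopologicalSpace E] [IsTopologicalAddGroup E]
  [ContinuousSMul ℝ E] [LocallyConvexSpace ℝ E] [T2Space E] {P : Set E}

theorem mem_exposedPoints_of_notMem_convexHull_sdiff {S : Set E} {v : E} (hS : S.Finite)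
    (hv : v ∈ S) (hvS : v ∉ convexHull ℝ (S \ {v})) : v ∈ (convexHull ℝ S).exposedPoints ℝ := by
  obtain ⟨ℓ, c, hlt, hvc⟩ := geometric_hahn_banach_closed_point (convex_convexHull ℝ _)
    (hS.sdiff.isClosed_convexHull ℝ) hvS
  have hltv : ∀ u ∈ S, u ≠ v → ℓ u < ℓ v := fun u hu huv =>
    (hlt u (subset_convexHull ℝ _ ⟨hu, huv⟩)).trans hvc
  have hmax : ∀ u ∈ S, ℓ u ≤ ℓ v := fun u hu => by
    obtain rfl | huv := eq_or_ne u v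
    exacts [le_rfl, (hltv u hu huv).le]
  have hface : ℓ.toExposed S = {v} := Set.eq_singleton_iff_unique_mem.2
    ⟨⟨hv, hmax⟩, fun u hu => by_contra fun huv => (hltv u hu.1 huv).not_ge (hu.2 v hv)⟩
  refine mem_exposedPoints_iff_exposed_singleton.2 ?_
  rw [← convexHull_singleton (𝕜 := ℝ) v, ← hface]
  exact isExposed_convexHull ContinuousLinearMap.toExposed.isExposed

theorem IsPolytope.convexHull_exposedPoints (hP : IsPolytope P) :
    convexHull ℝ (P.exposedPoints ℝ) = P := by
  classical
  obtain ⟨S, hPS : P = _, hmin⟩ :=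
    exists_minimal_of_wellFoundedLT (fun S : Finset E => P = convexHull ℝ (S : Set E)) hP
  refine (convexHull_min exposedPoints_subset (hPS ▸ convex_convexHull ℝ _)).antisymm ?_
  nth_rw 1 [hPS]
  refine convexHull_mono fun v hv => ?_
  rw [hPS]
  refine mem_exposedPoints_of_notMem_convexHull_sdiff S.finite_toSet hv fun hvS => ?_
  have hsub : (S : Set E) ⊆ convexHull ℝ (S.erase v : Finset E) := fun u hu => by
    rw [Finset.coe_erase]
    obtain rfl | huv := eq_or_ne u v
    exacts [hvS, subset_convexHull ℝ _ ⟨hu, huv⟩]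
  have herase : P = convexHull ℝ (S.erase v : Set E) := hPS.trans
    ((convexHull_min hsub (convex_convexHull ℝ _)).antisymm
      (convexHull_mono (Finset.coe_subset.2 (S.erase_subset v))))
  exact Finset.notMem_erase v S (hmin herase (S.erase_subset v) hv)

theorem IsPolytope.dim_eq_finrank_exposedPoints (hP : IsPolytope P) :
    dim P = Module.finrank ℝ (vectorSpan ℝ (P.exposedPoints ℝ)) := by
  rw [← dim_convexHull, hP.convexHull_exposedPoints]

theorem IsPolytope.exists_isFacet (hP : IsPolytope P) (hdim : 1 ≤ dim P) : ∃ F, IsFacet P F := by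
  have hnt : (P.exposedPoints ℝ).Nontrivial := by
    by_contra h
    rw [hP.dim_eq_finrank_exposedPoints,
      vectorSpan_of_subsingleton ℝ (Set.not_nontrivial_iff.1 h), finrank_bot] at hdim
    exact Nat.not_succ_le_zero 0 hdim
  obtain ⟨F, hF, hne, hfin⟩ :=
    exists_isExposed_finrank_vectorSpan_add_one hP.finite_exposedPoints hnt
  refine ⟨convexHull ℝ F, ?_, hne.convexHull, ?_⟩
  · simpa only [hP.convexHull_exposedPoints] using isExposed_convexHull hF
  · rw [dim_convexHull, hfin, hP.dim_eq_finrank_exposedPoints]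

theorem IsPolytope.adj_of_isExposed (hP : IsPolytope P) {v w : P.exposedPoints ℝ} (hvw : v ≠ w)
    (h : IsExposed ℝ (P.exposedPoints ℝ) {(v : E), (w : E)}) : (graph P).Adj v w := by
  refine ⟨hvw, ?_⟩
  simpa only [hP.convexHull_exposedPoints, convexHull_pair] using isExposed_convexHull h

end Vertices

section Connectivity

variable {E : Type*} [AddCommGroup E] [Module ℝ E] [TopologicalSpace E] [IsTopologicalAddGroup E]
  [ContinuousSMul ℝ E] [LocallyConvexSpace ℝ E] [T2Space E] {P T : Set E}
  {x y : P.exposedPoints ℝ} {f : StrongDual ℝ E} {c : ℝ}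

theorem IsPolytope.exists_adj_lt (hP : IsPolytope P) (hT : IsExposed ℝ (P.exposedPoints ℝ) T)
    (hx : (x : E) ∈ T) (hlt : ∃ u ∈ T, f x < f u) :
    ∃ y, (graph P).Adj x y ∧ (y : E) ∈ T ∧ f x < f y := by
  obtain ⟨u, hu, hxu⟩ := hlt
  have hTexp : T ⊆ T.exposedPoints ℝ := fun v hv =>
    mem_exposedPoints_of_subset (hT.subset.trans exposedPoints_subset) hv (hT.subset hv)
  obtain ⟨y, hy, hxy, hedge⟩ :=
    exists_isExposed_pair (hP.finite_exposedPoints.subset hT.subset) hTexp f hx hu hxu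
  refine ⟨⟨y, hT.subset hy⟩, hP.adj_of_isExposed ?_ ?_, hy, hxy⟩
  · rintro rfl
    exact hxy.false
  · exact isExposed_trans_of_finite hP.finite_exposedPoints hT hedge

/-- This is the simplex method: improving edges lead to the maximum of `f` on a face. -/
theorem IsPolytope.exists_reachableIn_mem_toExposed (hP : IsPolytope P)
    (hT : IsExposed ℝ (P.exposedPoints ℝ) T) (hx : (x : E) ∈ T) (f : StrongDual ℝ E) :
    ∃ y : P.exposedPoints ℝ, (y : E) ∈ f.toExposed T ∧
      ReachableIn (graph P) {w | (w : E) ∈ T ∧ f x ≤ f w} x y := by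
  have : Finite (P.exposedPoints ℝ) := hP.finite_exposedPoints
  obtain ⟨y, hxy, hmax⟩ := Set.exists_max_image
    {y | ReachableIn (graph P) {w | (w : E) ∈ T ∧ f x ≤ f w} x y} (fun y => f y) (Set.toFinite _)
    ⟨x, .refl ⟨hx, le_rfl⟩⟩
  obtain ⟨hyT, hfxy⟩ := hxy.right_mem
  refine ⟨y, ⟨hyT, fun u hu => ?_⟩, hxy⟩
  by_contra! hyu
  obtain ⟨z, hyz, hzT, hlt⟩ := hP.exists_adj_lt hT hyT ⟨u, hu, hyu⟩
  exact (hmax z (hxy.trans (.of_adj hyz ⟨hyT, hfxy⟩ ⟨hzT, hfxy.trans hlt.le⟩))).not_gt hlt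

/-- Climb from both vertices to the face maximising `f`, and then within this face to a common
vertex. -/
theorem IsPolytope.reachableIn_gt (hP : IsPolytope P) (hx : c < f x) (hy : c < f y) :
    ReachableIn (graph P) {w | c < f w} x y := by
  have hface : IsExposed ℝ (P.exposedPoints ℝ) (f.toExposed (P.exposedPoints ℝ)) :=
    ContinuousLinearMap.toExposed.isExposed
  obtain ⟨x', hx', hxx'⟩ := hP.exists_reachableIn_mem_toExposed (.refl _) x.2 f
  obtain ⟨y', hy', hyy'⟩ := hP.exists_reachableIn_mem_toExposed (.refl _) y.2 f
  obtain ⟨ℓ, hℓ⟩ := exists_toExposed_eq_singleton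
    (mem_exposedPoints_of_subset (hface.subset.trans exposedPoints_subset) hx' x'.2)
  obtain ⟨z, hz, hyz⟩ := hP.exists_reachableIn_mem_toExposed hface hy' ℓ
  obtain rfl : z = x' := Subtype.ext (hℓ.le hz)
  refine (hxx'.mono fun w hw => hx.trans_le hw.2).trans (.symm ?_)
  refine (hyy'.mono fun w hw => hy.trans_le hw.2).trans (hyz.mono fun w hw => ?_)
  exact hy.trans_le (hw.1.2 y y.2)

theorem IsPolytope.reachableIn_ge (hP : IsPolytope P) (hc : ∃ u ∈ P.exposedPoints ℝ, c < f u)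
    (hx : c ≤ f x) (hy : c ≤ f y) :
    ReachableIn (graph P) {w | c < f w ∨ w = x ∨ w = y} x y := by
  have hup : ∀ v : P.exposedPoints ℝ, c ≤ f v → v = x ∨ v = y →
      ∃ w : P.exposedPoints ℝ, c < f w ∧
        ReachableIn (graph P) {w | c < f w ∨ w = x ∨ w = y} v w := by
    intro v hv hvxy
    obtain hlt | rfl := hv.lt_or_eq
    · exact ⟨v, hlt, .refl (.inl hlt)⟩
    · obtain ⟨w, hvw, -, hlt⟩ := hP.exists_adj_lt (.refl _) v.2 hc
      exact ⟨w, hlt, .of_adj hvw (.inr hvxy) (.inl hlt)⟩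
  obtain ⟨x', hx', hxx'⟩ := hup x hx (.inl rfl)
  obtain ⟨y', hy', hyy'⟩ := hup y hy (.inr rfl)
  exact hxx'.trans (((hP.reachableIn_gt hx' hy').mono fun w hw => .inl hw).trans hyy'.symm)

theorem IsPolytope.reachableIn_le (hP : IsPolytope P) (hc : ∃ u ∈ P.exposedPoints ℝ, f u < c)
    (hx : f x ≤ c) (hy : f y ≤ c) :
    ReachableIn (graph P) {w | f w < c ∨ w = x ∨ w = y} x y := by
  simpa using hP.reachableIn_ge (f := -f) (c := -c) (x := x) (y := y) (by simpa using hc)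
    (by simpa using hx) (by simpa using hy)

theorem IsPolytope.exists_strongDual_const_on (hP : IsPolytope P) {T : Finset E} {v : E}
    (hT : T.card ≤ dim P) (hv : v ∈ T) : ∃ f : StrongDual ℝ E, (∀ x ∈ T, f x = f v) ∧
      ∃ w ∈ P.exposedPoints ℝ, f v < f w := by
  refine Polytope.exists_strongDual_const_on T.finite_toSet (fun hle => ?_) hv
  have := finiteDimensional_vectorSpan_of_finite ℝ T.finite_toSet
  have hlt := (Submodule.finrank_mono hle).trans_lt (finrank_vectorSpan_lt_card T ⟨v, hv⟩)
  rw [← hP.dim_eq_finrank_exposedPoints] at hlt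
  exact hlt.not_ge hT

/-- **Balinski's theorem**. -/
theorem IsPolytope.isVertexConnected_graph (hP : IsPolytope P) :
    IsVertexConnected (graph P) (dim P) := by
  classical
  intro Y hY x hx y hy
  obtain ⟨f, hf, w, hw, hxw⟩ := hP.exists_strongDual_const_on
    (T := (insert x Y).image Subtype.val) (v := x)
    (Finset.card_image_le.trans ((Finset.card_insert_le _ _).trans hY)) (by simp)
  have hfY : ∀ z ∈ Y, f z = f x := fun z hz => hf z (by simp [hz])
  obtain hxy | hyx := le_or_gt (f x) (f y)
  · refine (hP.reachableIn_ge ⟨w, hw, hxw⟩ le_rfl hxy).mono ?_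
    rintro z (hz | rfl | rfl) hzY
    exacts [hz.ne' (hfY z hzY), hx hzY, hy hzY]
  · refine (hP.reachableIn_le ⟨y, y.2, hyx⟩ le_rfl hyx.le).mono ?_
    rintro z (hz | rfl | rfl) hzY
    exacts [hz.ne (hfY z hzY), hx hzY, hy hzY]

theorem IsPolytope.linkable_of_apply_eq (hP : IsPolytope P) {s t : Fin 2 → P.exposedPoints ℝ}
    (hst : Function.Injective (Sum.elim s t)) (hlt : ∃ u ∈ P.exposedPoints ℝ, f u < c)
    (hgt : ∃ u ∈ P.exposedPoints ℝ, c < f u) (hs₀ : f (s 0) = c) (ht₀ : f (t 0) = c)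
    (hs₁ : f (s 1) = c) (ht₁ : c ≤ f (t 1)) : Linkable (graph P) Set.univ s t := by
  have hdisj : Disjoint {w : P.exposedPoints ℝ | f w < c ∨ w = s 0 ∨ w = t 0}
      {w | c < f w ∨ w = s 1 ∨ w = t 1} := by
    have hne : ∀ p q, p ≠ q → Sum.elim s t p ≠ Sum.elim s t q := fun p q => hst.ne
    have hss := hne (.inl 0) (.inl 1) (by simp)
    have hst := hne (.inl 0) (.inr 1) (by simp)
    have hts := hne (.inr 0) (.inl 1) (by simp)
    have htt := hne (.inr 0) (.inr 1) (by simp)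
    rw [Set.disjoint_left]
    rintro w (hw | rfl | rfl) (hw' | h | h)
    exacts [lt_asymm hw hw', hw.ne (h ▸ hs₁), (h ▸ ht₁).not_gt hw, hw'.ne' hs₀, hss h, hst h,
      hw'.ne' ht₀, hts h, htt h]
  refine ⟨![{w | f w < c ∨ w = s 0 ∨ w = t 0}, {w | c < f w ∨ w = s 1 ∨ w = t 1}],
    fun i => Set.subset_univ _, Fin.forall_fin_two.2 ⟨?_, ?_⟩, ?_⟩
  · exact hP.reachableIn_le hlt hs₀.le ht₀.le
  · exact hP.reachableIn_ge hgt hs₁.ge ht₁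
  · intro i j hij
    fin_cases i <;> fin_cases j
    exacts [absurd rfl hij, hdisj, hdisj.symm, absurd rfl hij]

/-- A hyperplane through three of the four vertices and the centroid of all vertices has vertices
strictly on either side, so one pair can be joined on each side of it. -/
theorem IsPolytope.linkable_graph_fin_two (hP : IsPolytope P) (hdim : 4 ≤ dim P)
    {s t : Fin 2 → P.exposedPoints ℝ} (hst : Function.Injective (Sum.elim s t)) :
    Linkable (graph P) Set.univ s t := by
  classical
  let V := hP.finite_exposedPoints.toFinset
  let z : E := (V.card : ℝ)⁻¹ • ∑ u ∈ V, u
  obtain ⟨f, hf, w, hw, hzw⟩ := hP.exists_strongDual_const_on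
    (T := {(s 0 : E), (t 0 : E), (s 1 : E), z}) (v := z) (Finset.card_le_four.trans hdim) (by simp)
  have hs₀ : f (s 0) = f z := hf _ (by simp)
  have ht₀ : f (t 0) = f z := hf _ (by simp)
  have hs₁ : f (s 1) = f z := hf _ (by simp)
  have hlt : ∃ u ∈ P.exposedPoints ℝ, f u < f z := by
    obtain ⟨u, hu, huz⟩ := exists_apply_lt_apply_average (f : E →ₗ[ℝ] ℝ)
      (hP.finite_exposedPoints.mem_toFinset.2 hw) hzw
    exact ⟨u, hP.finite_exposedPoints.mem_toFinset.1 hu, huz⟩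
  obtain hle | hle := le_total (f z) (f (t 1))
  · exact hP.linkable_of_apply_eq hst hlt ⟨w, hw, hzw⟩ hs₀ ht₀ hs₁ hle
  · exact hP.linkable_of_apply_eq (f := -f) (c := -f z) hst ⟨w, hw, neg_lt_neg hzw⟩
      (hlt.imp fun u hu => ⟨hu.1, neg_lt_neg hu.2⟩) (congrArg Neg.neg hs₀) (congrArg Neg.neg ht₀)
      (congrArg Neg.neg hs₁) (neg_le_neg hle)

end Connectivity

section CombinatorialType

variable {E : Type*} [AddCommGroup E] [Module ℝ E] [TopologicalSpace E] {P F : Set E}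
  {v w : P.exposedPoints ℝ} {a : FaceLattice P}

/-- The face of `P` consisting of the vertex `v` alone. -/
def vertexFace (v : P.exposedPoints ℝ) : FaceLattice P :=
  ⟨{(v : E)}, mem_exposedPoints_iff_exposed_singleton.1 v.2⟩

theorem vertexFace_le_iff : vertexFace v ≤ a ↔ (v : E) ∈ a.1 :=
  Set.singleton_subset_iff

theorem vertexFace_injective :
    Function.Injective (vertexFace : P.exposedPoints ℝ → FaceLattice P) := fun _ _ h =>
  Subtype.ext (Set.singleton_injective (congrArg Subtype.val h))

theorem isBot_iff_eq_empty : IsBot a ↔ a.1 = ∅ :=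
  ⟨fun h => Set.subset_empty_iff.1 (h ⟨∅, isExposed_empty⟩), fun h b => by
    rw [← Subtype.coe_le_coe, h]
    exact Set.empty_subset _⟩

theorem IsPolytope.isContained_graph_of_isExposed (hP : IsPolytope P) (hF : IsExposed ℝ P F) :
    (graph F).IsContained (graph P) :=
  ⟨⟨⟨fun v => ⟨v, mem_exposedPoints_iff_exposed_singleton.2
      (hP.isExposed_trans hF (mem_exposedPoints_iff_exposed_singleton.1 v.2))⟩,
    fun h => ⟨fun hvw => h.1 (Subtype.ext (Subtype.mk.inj hvw)), hP.isExposed_trans hF h.2⟩⟩,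
    fun _ _ hvw => Subtype.ext (Subtype.mk.inj hvw)⟩⟩

variable [IsTopologicalAddGroup E] [ContinuousSMul ℝ E] [LocallyConvexSpace ℝ E] [T2Space E]
  {E' : Type*} [AddCommGroup E'] [Module ℝ E'] [TopologicalSpace E'] [IsTopologicalAddGroup E']
  [ContinuousSMul ℝ E'] [LocallyConvexSpace ℝ E'] [T2Space E'] {Q : Set E'}

theorem IsPolytope.exists_vertexFace_le (hP : IsPolytope P) (ha : ¬ IsBot a) :
    ∃ v, vertexFace v ≤ a := by
  rw [isBot_iff_eq_empty, ← Ne, ← Set.nonempty_iff_ne_empty,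
    ← (hP.of_isExposed a.2).convexHull_exposedPoints, convexHull_nonempty_iff] at ha
  obtain ⟨v, hv⟩ := ha
  exact ⟨⟨v, mem_exposedPoints_iff_exposed_singleton.2
    (hP.isExposed_trans a.2 (mem_exposedPoints_iff_exposed_singleton.1 hv))⟩,
    vertexFace_le_iff.2 (exposedPoints_subset hv)⟩

theorem IsPolytope.minimal_not_isBot_iff (hP : IsPolytope P) :
    Minimal (fun b => ¬ IsBot b) a ↔ ∃ v, vertexFace v = a := by
  have hbot : ∀ v : P.exposedPoints ℝ, ¬ IsBot (vertexFace v) := fun v h =>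
    Set.singleton_ne_empty _ (isBot_iff_eq_empty.1 h)
  constructor
  · intro ha
    obtain ⟨v, hv⟩ := hP.exists_vertexFace_le ha.prop
    exact ⟨v, hv.antisymm (ha.le_of_le (hbot v) hv)⟩
  · rintro ⟨v, rfl⟩
    refine ⟨hbot v, fun b hb hbv => ?_⟩
    obtain ⟨w, hw⟩ := hP.exists_vertexFace_le hb
    rwa [← Subtype.ext (vertexFace_le_iff.1 (hw.trans hbv))]

theorem IsPolytope.exists_orderIso_vertexFace (hP : IsPolytope P) (hQ : IsPolytope Q)
    (Φ : FaceLattice P ≃o FaceLattice Q) (v : P.exposedPoints ℝ) :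
    ∃ w, vertexFace w = Φ (vertexFace v) := by
  have hbot : ∀ b, IsBot (Φ b) ↔ IsBot b := fun b => by
    simp only [IsBot, Φ.surjective.forall, Φ.le_iff_le]
  rw [← hQ.minimal_not_isBot_iff]
  have hv := hP.minimal_not_isBot_iff.2 ⟨v, rfl⟩
  refine ⟨(hbot _).not.2 hv.prop, Φ.surjective.forall.2 fun b hb hbv => ?_⟩
  exact Φ.monotone (hv.le_of_le ((hbot b).not.1 hb) (Φ.le_iff_le.1 hbv))

theorem IsPolytope.adj_iff_exists_face (hP : IsPolytope P) :
    (graph P).Adj v w ↔ v ≠ w ∧ ∃ e : FaceLattice P, ∀ u, vertexFace u ≤ e ↔ u = v ∨ u = w := by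
  refine and_congr_right fun hvw => ⟨fun h => ⟨⟨_, h⟩, fun u => ?_⟩, fun ⟨e, he⟩ => ?_⟩
  · rw [vertexFace_le_iff]
    constructor
    · intro hu
      obtain h | h := (mem_extremePoints_iff_forall_segment.1
        (exposedPoints_subset_extremePoints u.2)).2 v (exposedPoints_subset v.2) w
          (exposedPoints_subset w.2) hu
      exacts [.inl (Subtype.ext h.symm), .inr (Subtype.ext h.symm)]
    · rintro (rfl | rfl)
      exacts [left_mem_segment ℝ _ _, right_mem_segment ℝ _ _]
  · have hexp : e.1.exposedPoints ℝ = {(v : E), (w : E)} := by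
      refine Set.Subset.antisymm (fun u hu => ?_) (Set.pair_subset ?_ ?_)
      · have hu' : u ∈ P.exposedPoints ℝ := mem_exposedPoints_iff_exposed_singleton.2
          (hP.isExposed_trans e.2 (mem_exposedPoints_iff_exposed_singleton.1 hu))
        exact ((he ⟨u, hu'⟩).1 (vertexFace_le_iff.2 (exposedPoints_subset hu))).imp
          (congrArg Subtype.val) (congrArg Subtype.val)
      · exact mem_exposedPoints_of_subset e.2.subset
          (vertexFace_le_iff.1 ((he v).2 (.inl rfl))) v.2
      · exact mem_exposedPoints_of_subset e.2.subset
          (vertexFace_le_iff.1 ((he w).2 (.inr rfl))) w.2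
    rw [← convexHull_pair, ← hexp, (hP.of_isExposed e.2).convexHull_exposedPoints]
    exact e.2

theorem CombEquiv.nonempty_graph_iso (h : CombEquiv P Q) (hP : IsPolytope P)
    (hQ : IsPolytope Q) : Nonempty (graph P ≃g graph Q) := by
  obtain ⟨Φ⟩ := h
  choose f hf using hP.exists_orderIso_vertexFace hQ Φ
  choose g hg using hQ.exists_orderIso_vertexFace hP Φ.symm
  have hle : ∀ v e, vertexFace (f v) ≤ Φ e ↔ vertexFace v ≤ e := fun v e => by
    rw [hf, Φ.le_iff_le]
  let f' : P.exposedPoints ℝ ≃ Q.exposedPoints ℝ :=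
    ⟨f, g, fun v => vertexFace_injective (by rw [hg, hf, Φ.symm_apply_apply]),
      fun w => vertexFace_injective (by rw [hf, hg, Φ.apply_symm_apply])⟩
  refine ⟨⟨f', fun {v w} => ?_⟩⟩
  rw [hP.adj_iff_exists_face, hQ.adj_iff_exists_face, f'.injective.ne_iff, Φ.surjective.exists]
  simp only [f'.surjective.forall, f'.injective.eq_iff]
  simp only [f', Equiv.coe_fn_mk, hle]

end CombinatorialType

section UnitCube

variable {m : ℕ}

/-- The vertex of `[0, 1]^m` whose coordinates equal to `1` are those at which `p` is `true`. -/
def cubePoint (p : Fin m → Bool) : Fin m → ℝ := fun i => if p i then 1 else 0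

theorem cubePoint_injective : Function.Injective (cubePoint (m := m)) := fun p q h =>
  funext fun i => by
    have hi := congrFun h i
    cases hp : p i <;> cases hq : q i <;> simp [cubePoint, hp, hq] at hi ⊢

theorem convexHull_range_cubePoint :
    convexHull ℝ (Set.range (cubePoint (m := m))) = unitCube m := by
  have hrange : Set.range (cubePoint (m := m)) = Set.univ.pi fun _ => {0, 1} := by
    ext x
    refine ⟨?_, fun hx => ⟨fun i => decide (x i = 1), funext fun i => ?_⟩⟩
    · rintro ⟨p, rfl⟩ i -
      cases h : p i <;> simp [cubePoint, h]
    · obtain h | h : x i = 0 ∨ x i = 1 := hx i trivial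
      all_goals simp [cubePoint, h]
  rw [hrange, convexHull_pi, unitCube, ← Set.pi_univ_Icc]
  simp only [convexHull_pair, segment_eq_Icc zero_le_one, Pi.zero_apply, Pi.one_apply]

theorem isPolytope_unitCube (m : ℕ) : IsPolytope (unitCube m) :=
  ⟨(Set.finite_range cubePoint).toFinset, by
    rw [Set.Finite.coe_toFinset, convexHull_range_cubePoint]⟩

theorem isExposed_range_cubePoint (p : Fin m → Bool) (J : Finset (Fin m)) :
    IsExposed ℝ (Set.range cubePoint) (cubePoint '' {r | ∀ i ∉ J, r i = p i}) := by
  intro _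
  let c : Fin m → ℝ := fun i => if i ∈ J then 0 else if p i then 1 else -1
  let ℓ : StrongDual ℝ (Fin m → ℝ) := ∑ i, c i • ContinuousLinearMap.proj i
  have hℓ : ∀ q, ℓ (cubePoint q) = ∑ i, c i * cubePoint q i := fun q => by simp [ℓ]
  have hle : ∀ q i, c i * cubePoint q i ≤ c i * cubePoint p i := fun q i => by
    by_cases hi : i ∈ J <;> cases hp : p i <;> cases hq : q i <;> simp [c, cubePoint, hi, hp, hq]
  have heq : ∀ q i, c i * cubePoint q i = c i * cubePoint p i ↔ i ∈ J ∨ q i = p i := fun q i => by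
    by_cases hi : i ∈ J <;> cases hp : p i <;> cases hq : q i <;> simp [c, cubePoint, hi, hp, hq]
  have hmax : ∀ q, ℓ (cubePoint q) ≤ ℓ (cubePoint p) := fun q => by
    rw [hℓ, hℓ]
    exact Finset.sum_le_sum fun i _ => hle q i
  have hmax_iff : ∀ q, ℓ (cubePoint p) ≤ ℓ (cubePoint q) ↔ ∀ i ∉ J, q i = p i := fun q => by
    rw [(hmax q).ge_iff_eq, hℓ, hℓ, Finset.sum_eq_sum_iff_of_le fun i _ => hle q i]
    simp only [Finset.mem_univ, forall_true_left, heq, or_iff_not_imp_left]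
  refine ⟨ℓ, Set.Subset.antisymm ?_ ?_⟩
  · rintro _ ⟨q, hq, rfl⟩
    exact ⟨⟨q, rfl⟩, Set.forall_mem_range.2 fun r => (hmax r).trans ((hmax_iff q).2 hq)⟩
  · rintro _ ⟨⟨q, rfl⟩, hq⟩
    exact ⟨q, (hmax_iff q).1 (hq _ ⟨p, rfl⟩), rfl⟩

theorem isExposed_unitCube (p : Fin m → Bool) (J : Finset (Fin m)) :
    IsExposed ℝ (unitCube m) (convexHull ℝ (cubePoint '' {r | ∀ i ∉ J, r i = p i})) := by
  rw [← convexHull_range_cubePoint]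
  exact isExposed_convexHull (isExposed_range_cubePoint p J)

theorem isContained_cubeGraph_graph_unitCube (m : ℕ) :
    (cubeGraph m).IsContained (graph (unitCube m)) := by
  have hvertex : ∀ p, cubePoint p ∈ (unitCube m).exposedPoints ℝ := fun p => by
    have h := isExposed_unitCube p ∅
    have hp : {r | ∀ i ∉ (∅ : Finset (Fin m)), r i = p i} = {p} := by
      ext r
      simp [funext_iff]
    rw [hp, Set.image_singleton, convexHull_singleton] at h
    exact mem_exposedPoints_iff_exposed_singleton.2 h
  refine ⟨⟨⟨fun p => ⟨cubePoint p, hvertex p⟩, fun {p q} hpq => ⟨fun h => ?_, ?_⟩⟩,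
    fun p q h => ?_⟩⟩
  · exact hpq.ne (cubePoint_injective (congrArg Subtype.val h))
  · obtain ⟨i, rfl⟩ := hpq
    have h := isExposed_unitCube p {i}
    have hedge : {r | ∀ j ∉ ({i} : Finset (Fin m)), r j = p j} =
        {p, Function.update p i (!p i)} := by
      ext r
      simp only [Finset.mem_singleton, Set.mem_ofPred_eq, Set.mem_insert_iff,
        Set.mem_singleton_iff, Function.eq_update_iff]
      constructor
      · intro h
        obtain hr | hr := Bool.eq_or_eq_not (r i) (p i)
        · exact .inl (funext fun j => if hj : j = i then hj ▸ hr else h j hj)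
        · exact .inr ⟨hr, h⟩
      · rintro (rfl | h) j hj
        exacts [rfl, h.2 j hj]
    rwa [hedge, Set.image_pair, convexHull_pair] at h
  · exact cubePoint_injective (congrArg Subtype.val h)

end UnitCube

section CubicalPolytopes

variable {E : Type*} [AddCommGroup E] [Module ℝ E] [TopologicalSpace E] [IsTopologicalAddGroup E]
  [ContinuousSMul ℝ E] [LocallyConvexSpace ℝ E] [T2Space E] {P : Set E} {d : ℕ}

theorem IsPolytope.dim_lt_card_exposedPoints (hP : IsPolytope P) (hne : P.Nonempty) :
    dim P < Nat.card (P.exposedPoints ℝ) := by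
  have hfin := hP.finite_exposedPoints
  rw [hP.dim_eq_finrank_exposedPoints, Nat.card_coe_set_eq, Set.ncard_eq_toFinset_card _ hfin]
  rw [← hP.convexHull_exposedPoints, convexHull_nonempty_iff] at hne
  have hlt := finrank_vectorSpan_lt_card hfin.toFinset (hfin.toFinset_nonempty.2 hne)
  rwa [hfin.coe_toFinset] at hlt

theorem IsCubicalPolytope.isContained_cubeGraph (hP : IsCubicalPolytope d P) (hd : 1 ≤ d) :
    (cubeGraph (d - 1)).IsContained (graph P) := by
  obtain ⟨F, hF⟩ := hP.isPolytope.exists_isFacet (hP.dim_eq ▸ hd)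
  have hdim : dim F = d - 1 := by
    rw [← hP.dim_eq, ← hF.2.2, Nat.add_sub_cancel]
  obtain ⟨φ⟩ := (hP.cubical F hF).nonempty_graph_iso (hP.isPolytope.of_isExposed hF.1)
    (isPolytope_unitCube _)
  rw [← hdim]
  exact (isContained_cubeGraph_graph_unitCube _).trans
    (φ.symm.isContained.trans (hP.isPolytope.isContained_graph_of_isExposed hF.1))

theorem IsCubicalPolytope.linkable_graph (hP : IsCubicalPolytope d P) {k : ℕ} (hk : 2 * k ≤ d)
    {s t : Fin k → P.exposedPoints ℝ} (hst : Function.Injective (Sum.elim s t)) :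
    Linkable (graph P) Set.univ s t := by
  have : Finite (P.exposedPoints ℝ) := hP.isPolytope.finite_exposedPoints
  have hconn : IsVertexConnected (graph P) (2 * k) := fun Y hY =>
    hP.isPolytope.isVertexConnected_graph (hY.trans_le (hk.trans_eq hP.dim_eq.symm))
  obtain hk1 | rfl | hk3 : k ≤ 1 ∨ k = 2 ∨ 3 ≤ k := by omega
  · have := Fin.subsingleton_iff_le_one.2 hk1
    refine linkable_of_subsingleton fun i => ?_
    simpa using hconn (Y := ∅) (by simpa using i.pos) (s i) (by simp) (t i) (by simp)
  · exact hP.isPolytope.linkable_graph_fin_two (hk.trans_eq hP.dim_eq.symm) hst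
  · refine IsVertexConnected.linkable_of_isContained (by simpa using hconn)
      (hP.isContained_cubeGraph (by omega)) ?_ (fun s t hst => ?_) hst
    · have := Nat.lt_two_pow_self (n := d - 1)
      simp only [Fintype.card_fin, Nat.card_eq_fintype_card, Fintype.card_pi, Fintype.card_bool,
        Finset.prod_const, Finset.card_univ]
      omega
    · simpa using cubeGraph.linkable_compl (F := ∅) hst (by simp)
        (by simp only [Fintype.card_fin, Finset.card_empty]; omega) (.inl (by omega))

end CubicalPolytopes

end Polytope

theorem mainTheorem7_general {E : Type*} [AddCommGroup E] [Module ℝ E] [TopologicalSpace E]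
    [IsTopologicalAddGroup E] [ContinuousSMul ℝ E] [LocallyConvexSpace ℝ E] [T2Space E] {P : Set E}
    {d : ℕ} (hP : Polytope.IsCubicalPolytope d P) : (Polytope.graph P).IsLinked (d / 2) := by
  have hk : 2 * (d / 2) ≤ d := Nat.mul_div_le d 2
  have : Finite (P.exposedPoints ℝ) := hP.isPolytope.finite_exposedPoints
  refine isLinked_of_linkable ?_ fun s t hst => hP.linkable_graph hk hst
  rw [ENat.card_eq_coe_natCard, Nat.cast_le]
  have hcard := hP.isPolytope.dim_lt_card_exposedPoints hP.nonempty
  rw [hP.dim_eq] at hcard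
  exact hk.trans hcard.le

theorem mainTheorem7 (d : ℕ) (hd : 1 ≤ d) (n : ℕ) (P : Set (EuclideanSpace ℝ (Fin n)))
    (hP : Polytope.IsCubicalPolytope d P) : (Polytope.graph P).IsLinked (d / 2) :=
  mainTheorem7_general hP
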